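/- For each even $n$ consider a two-block stochastic blockmodel on $n$ nodes with two communities of equal size $n/2$: the adjacency matrix $A$ is symmetric with zero diagonal and, given the communities, has independent entries above the diagonal, with $\mathbb P(A_{ij}=1)=p_0$ if $i,j$ are in the same community and $\mathbb P(A_{ij}=1)=q_0$ otherwise. Here $0<q_0<p_0<1$ may depend on $n$, $p_0\asymp q_0\asymp\rho_n$ with $\rho_n>0$ (possibly, but not necessarily, tending to $0$), and $n\rho_n=\Omega(\log^2 n)$. Let $\psi^{(0)}\in(0,1)^n$ be independent of $A$ with i.i.d. entries from a distribution supported on $(0,1)$, which may depend on $n$, whose mean $\mu$ is bounded away from $0$ and $1$. With $J$ the all-ones matrix, $\mathbf 1$ the all-ones vector and $g(x)=1/(1+e^{-x})$, define for $s\ge 1$ (writing $\psi=\psi^{(s-1)}$ on the right-hand sides) $$p^{(s)}=\frac{\psi^\top A\psi+(\mathbf 1-\psi)^\top A(\mathbf 1-\psi)}{\psi^\top (J-I)\psi+(\mathbf 1-\psi)^\top (J-I)(\mathbf 1-\psi)},\qquad q^{(s)}=\frac{\psi^\top A(\mathbf 1-\psi)}{\psi^\top (J-I)(\mathbf 1-\psi)},$$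 $$t^{(s)}=\tfrac12\log\frac{p^{(s)}(1-q^{(s)})}{q^{(s)}(1-p^{(s)})},\qquad \lambda^{(s)}=\frac1{2t^{(s)}}\log\frac{1-q^{(s)}}{1-p^{(s)}},$$ $$\xi^{(s)}=4t^{(s)}\bigl(A-\lambda^{(s)}(J-I)\bigr)\bigl(\psi-\tfrac12\mathbf 1\bigr),\qquad \psi^{(s)}_i=g(\xi^{(s)}_i),$$ with the convention $\xi^{(s)}=0$ when $p^{(s)}=q^{(s)}$. Then, as $n\to\infty$, $$\bigl\|\psi^{(1)}-\tfrac12\mathbf 1\bigr\|_2=O_P(1),\qquad\text{and}\qquad \bigl\|\psi^{(s)}-\tfrac12\mathbf 1\bigr\|_2=O_P(\sqrt{\rho_n})\quad\text{for every fixed } s\ge 2.$$ -/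

import Mathlib

open MeasureTheory ProbabilityTheory Filter Asymptotics
open scoped Matrix Topology

noncomputable section

namespace BCAVI

/-- `X m = O_P(r m)` as `m → ∞`, where `X m` lives on its own probability space `(Ω m, P m)`. -/
def IsBigOP {Ω : ℕ → Type*} [∀ m, MeasurableSpace (Ω m)] (P : ∀ m, Measure (Ω m))
    (X : ∀ m, Ω m → ℝ) (r : ℕ → ℝ) : Prop :=
  ∀ ε : ℝ, 0 < ε → ∃ C : ℝ, 0 < C ∧
    ∀ᶠ m in atTop, P m {ω | C * r m < |X m ω|} ≤ ENNReal.ofReal ε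

/-- `A` is the adjacency matrix of a two-block stochastic blockmodel on `Fin n` with community
labels `z`: a random symmetric `0`-`1` matrix with zero diagonal whose entries above the diagonal
are independent, an entry being `1` with probability `p` inside a community and `q` between the
two communities. -/
structure IsSBM {Ω : Type*} [MeasurableSpace Ω] (P : Measure Ω) {n : ℕ} (z : Fin n → Bool)
    (p q : ℝ) (A : Ω → Matrix (Fin n) (Fin n) ℝ) : Prop where
  measurable_entry : ∀ i j, Measurable fun ω => A ω i j
  zero_or_one : ∀ ω i j, A ω i j = 0 ∨ A ω i j = 1
  symm : ∀ ω, (A ω).IsSymm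
  diag : ∀ ω i, A ω i i = 0
  prob : ∀ i j, i ≠ j → P.real {ω | A ω i j = 1} = if z i = z j then p else q
  indep : iIndepFun (fun (e : {e : Fin n × Fin n // e.1 < e.2}) (ω : Ω) => A ω e.1.1 e.1.2) P

/-- The entries of the random vector `ψ` are independent and identically distributed with
law `f`. -/
structure IsIID {Ω : Type*} [MeasurableSpace Ω] (P : Measure Ω) {n : ℕ} (f : Measure ℝ)
    (ψ : Ω → Fin n → ℝ) : Prop where
  hasLaw : ∀ i, HasLaw (fun ω => ψ ω i) f P
  indep : iIndepFun (fun i ω => ψ ω i) P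

variable {n : ℕ}

/-- `J - I`: the matrix with zeros on the diagonal and ones elsewhere. -/
def offDiag (n : ℕ) : Matrix (Fin n) (Fin n) ℝ := (Matrix.of fun _ _ => 1) - 1

/-- The update of the within-community probability. -/
def pUpdate (A : Matrix (Fin n) (Fin n) ℝ) (ψ : Fin n → ℝ) : ℝ :=
  (ψ ⬝ᵥ A *ᵥ ψ + (1 - ψ) ⬝ᵥ A *ᵥ (1 - ψ)) /
    (ψ ⬝ᵥ offDiag n *ᵥ ψ + (1 - ψ) ⬝ᵥ offDiag n *ᵥ (1 - ψ))

/-- The update of the between-community probability. -/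
def qUpdate (A : Matrix (Fin n) (Fin n) ℝ) (ψ : Fin n → ℝ) : ℝ :=
  (ψ ⬝ᵥ A *ᵥ (1 - ψ)) / (ψ ⬝ᵥ offDiag n *ᵥ (1 - ψ))

/-- `t = (1/2) log (p (1 - q) / (q (1 - p)))`. -/
def tParam (p q : ℝ) : ℝ := 1 / 2 * Real.log (p * (1 - q) / (q * (1 - p)))

/-- `λ = (1/(2t)) log ((1 - q) / (1 - p))`. If `p = q` then `t = 0`; the value of `λ` is then
irrelevant, as `λ` enters the updates only through the product `t (A - λ (J - I))`. -/
def lamParam (p q : ℝ) : ℝ := 1 / (2 * tParam p q) * Real.log ((1 - q) / (1 - p))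

/-- `ξ = 4 t (A - λ (J - I)) (ψ - 1/2)` with `t`, `λ` computed from the updated `p`, `q`. -/
def xiUpdate (A : Matrix (Fin n) (Fin n) ℝ) (ψ : Fin n → ℝ) : Fin n → ℝ :=
  (4 * tParam (pUpdate A ψ) (qUpdate A ψ)) •
    ((A - lamParam (pUpdate A ψ) (qUpdate A ψ) • offDiag n) *ᵥ (ψ - fun _ => 1 / 2))

/-- One batch update `ψ ↦ g(ξ)`, with `g` the sigmoid function `g x = 1 / (1 + exp (-x))`. -/
def psiUpdate (A : Matrix (Fin n) (Fin n) ℝ) (ψ : Fin n → ℝ) : Fin n → ℝ :=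
  fun i => Real.sigmoid (xiUpdate A ψ i)

/-- The iterate `ψ^(s)` started from `ψ^(0) = ψ₀`. -/
def iterate (A : Matrix (Fin n) (Fin n) ℝ) (ψ₀ : Fin n → ℝ) (s : ℕ) : Fin n → ℝ :=
  (psiUpdate A)^[s] ψ₀

/-- The Euclidean distance of `ψ` from the uninformative point `(1/2) 𝟏`. -/
def distHalf (ψ : Fin n → ℝ) : ℝ := ‖WithLp.toLp 2 (ψ - fun _ => 1 / 2)‖

end BCAVI

end

noncomputable section

namespace BCAVI

/-! Put `u = ψ - 1/2`, let `a` be the observed edge density and `Ã = A - a(J - I)`. Since `p` and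
`q` are symmetric under `u ↦ -u`, the terms linear in `u` cancel, and `p = a + W/(1 + U)`, `q = a -
W/(1 - U)`, where `W` and `U` are the quadratic forms of `Ã` and `J - I` at `u`, scaled by
`4/(n(n-1))` (`pUpdate_eq`, `qUpdate_eq`). So both estimates stay near `a`. If `|W|` is small
against `a` and `U` stays away from `±1`, then `t = O(W/a)` and, as the first-order terms cancel,
`t(a - λ) = O(W²/a)`. Splitting `ξ = 4t Ãu + 4t(a - λ)(J - I)u` and using `|g(x) - 1/2| ≤ |x|`
bounds one update by a multiple of `(W/a)‖Ãu‖ + (W²/a) n‖u‖` (`l2_psiUpdate_le`). Three estimates of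
`Ãu` feed this bound.

First update: `u` is independent of `A`, and its inner product with the community signs is
`O_P(√n)`, as the communities are balanced. Second moments give `‖Ãu‖ = O_P(n√a)` and `W =
O_P(√a/n)`, hence a bound `O_P(1)` (`first_step`).

Any update with `‖u‖ = O(1)`: the Frobenius norm of `Ã` is at most `n√a`, so the same orders hold
for every graph, even if `u` depends on it (`step_bounded`). Hence all iterates stay `O_P(1)`.

The same with all degrees `O(nρ)`: now `‖Ãu‖ = O(nρ)` and `W = O(ρ/n)`, so the new deviation is
`O(ρ)` (`step_contracts`). Chernoff's bound supplies the degrees. As `ρ` is eventually bounded, this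
is `O(√ρ)`; if `ρ` is bounded below, `O(1)` is already enough.

Two regimes escape the expansion. If `W` is not small against `a`, the graph has boundedly many
edges and its isolated vertices hardly move (`l2_psiUpdate_le_of_few_edges`). If `a > 1/2`, pass to
the complementary graph, which leaves the update unchanged (`psiUpdate_complement`). -/

/-! ### Scalar estimates for the sigmoid, `t` and `λ` -/

lemma abs_log_one_add_sub_le {x : ℝ} (hx : |x| ≤ 1 / 2) : |Real.log (1 + x) - x| ≤ 2 * x ^ 2 := by
  have h := Real.abs_log_sub_add_sum_range_le (x := -x) (by rw [abs_neg]; linarith) 1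
  simp only [Finset.range_one, Finset.sum_singleton, abs_neg, sub_neg_eq_add] at h
  norm_num at h
  rw [show Real.log (1 + x) - x = -x + Real.log (1 + x) by ring]
  refine h.trans ?_
  rw [div_le_iff₀ (by linarith)]
  nlinarith [sq_nonneg x]

lemma abs_log_one_add_le {x : ℝ} (hx : |x| ≤ 1 / 2) : |Real.log (1 + x)| ≤ 2 * |x| := by
  have h := abs_log_one_add_sub_le hx
  have h2 : 2 * x ^ 2 ≤ |x| := by rw [← sq_abs]; nlinarith [abs_nonneg x]
  have h3 := abs_sub_abs_le_abs_sub (Real.log (1 + x)) x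
  linarith

lemma abs_sigmoid_sub_half_le (x : ℝ) : |Real.sigmoid x - 1 / 2| ≤ |x| := by
  have key : ∀ y : ℝ, 0 ≤ y → |Real.sigmoid y - 1 / 2| ≤ y := by
    intro y hy
    have h1 : Real.sigmoid 0 ≤ Real.sigmoid y := Real.sigmoid_le hy
    rw [Real.sigmoid_zero] at h1
    rw [abs_of_nonneg (by linarith), Real.sigmoid_def]
    have h2 := Real.add_one_le_exp (-y)
    by_cases h3 : y ≤ 1 / 2
    · have : (1 + Real.exp (-y))⁻¹ ≤ (2 - y)⁻¹ := inv_anti₀ (by linarith) (by linarith)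
      have h4 : (2 - y)⁻¹ ≤ 1 / 2 + y := by
        rw [inv_le_iff_one_le_mul₀ (by linarith)]; nlinarith
      linarith
    · have : (1 + Real.exp (-y))⁻¹ ≤ 1 := inv_le_one_of_one_le₀ (by linarith [Real.exp_pos (-y)])
      linarith
  rcases le_total 0 x with h | h
  · rw [abs_of_nonneg h]; exact key x h
  · have := key (-x) (by linarith)
    rw [Real.sigmoid_neg] at this
    rw [abs_of_nonpos h, abs_sub_comm]
    convert this using 2; ring

lemma abs_sigmoid_sub_half_le_half (x : ℝ) : |Real.sigmoid x - 1 / 2| ≤ 1 / 2 := by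
  rw [abs_le]; constructor <;> linarith [Real.sigmoid_nonneg x, Real.sigmoid_le_one x]

section scalar
variable {a P Q w : ℝ}

/-- Both probabilities are expanded around the common value `a`, so that every logarithm has the
form `log (1 + x)` with `|x| ≤ 1/2`. -/
lemma log_div_parts (ha : 0 < a) (ha' : a ≤ 3 / 4) (hP : |P| ≤ w) (hQ : |Q| ≤ w)
    (hw : w ≤ a / 8) :
    2 * tParam (a + P) (a + Q) =
      Real.log (1 + P / a) - Real.log (1 + Q / a) + (Real.log (1 + -Q / (1 - a))
        - Real.log (1 + -P / (1 - a))) ∧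
    Real.log ((1 - (a + Q)) / (1 - (a + P))) =
      Real.log (1 + -Q / (1 - a)) - Real.log (1 + -P / (1 - a)) := by
  obtain ⟨hP1, hP2⟩ := abs_le.1 hP
  obtain ⟨hQ1, hQ2⟩ := abs_le.1 hQ
  have hp : 0 < a + P := by linarith
  have hq : 0 < a + Q := by linarith
  have hp' : 0 < 1 - (a + P) := by linarith
  have hq' : 0 < 1 - (a + Q) := by linarith
  have h1a : 0 < 1 - a := by linarith
  have e1 : 1 + P / a = (a + P) / a := by field_simp
  have e2 : 1 + Q / a = (a + Q) / a := by field_simp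
  have e3 : 1 + -Q / (1 - a) = (1 - (a + Q)) / (1 - a) := by field_simp; ring
  have e4 : 1 + -P / (1 - a) = (1 - (a + P)) / (1 - a) := by field_simp; ring
  have h2 : Real.log ((1 - (a + Q)) / (1 - (a + P))) =
      Real.log (1 + -Q / (1 - a)) - Real.log (1 + -P / (1 - a)) := by
    rw [e3, e4, Real.log_div hq'.ne' hp'.ne', Real.log_div hq'.ne' h1a.ne',
      Real.log_div hp'.ne' h1a.ne']
    ring
  refine ⟨?_, h2⟩
  rw [← h2, e1, e2, tParam, Real.log_div hp.ne' ha.ne', Real.log_div hq.ne' ha.ne',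
    Real.log_div hq'.ne' hp'.ne', Real.log_div (by positivity) (by positivity),
    Real.log_mul hp.ne' hq'.ne', Real.log_mul hq.ne' hp'.ne']
  ring

lemma abs_quotients (ha : 0 < a) (ha' : a ≤ 3 / 4) (hP : |P| ≤ w) (hw : w ≤ a / 8) :
    |P / a| ≤ 1 / 2 ∧ |-P / (1 - a)| ≤ 1 / 2 ∧ |P / a| ≤ w / a ∧ |-P / (1 - a)| ≤ w / (1 - a) := by
  have h1a : 0 < 1 - a := by linarith
  rw [abs_div, abs_div, abs_neg, abs_of_pos ha, abs_of_pos h1a]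
  refine ⟨?_, ?_, by gcongr, by gcongr⟩
  · rw [div_le_iff₀ ha]; linarith
  · rw [div_le_iff₀ h1a]; linarith

/-- Each of the four logarithms is at most twice its argument; `a ≤ 3/4` gives `1 - a ≥ a/3`, so the
quotients by `1 - a` cost only a factor `3`. -/
lemma abs_tParam_le (ha : 0 < a) (ha' : a ≤ 3 / 4) (hP : |P| ≤ w) (hQ : |Q| ≤ w)
    (hw : w ≤ a / 8) : |tParam (a + P) (a + Q)| ≤ 8 * (w / a) := by
  have h1a : 0 < 1 - a := by linarith
  have hw0 : 0 ≤ w := (abs_nonneg P).trans hP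
  obtain ⟨p1, p2, p3, p4⟩ := abs_quotients ha ha' hP hw
  obtain ⟨q1, q2, q3, q4⟩ := abs_quotients ha ha' hQ hw
  have h := (log_div_parts ha ha' hP hQ hw).1
  have l1 := abs_le.1 (abs_log_one_add_le p1)
  have l2 := abs_le.1 (abs_log_one_add_le p2)
  have l3 := abs_le.1 (abs_log_one_add_le q1)
  have l4 := abs_le.1 (abs_log_one_add_le q2)
  have hc : w / (1 - a) ≤ 3 * (w / a) := by
    rw [div_le_iff₀ h1a, mul_assoc, div_mul_eq_mul_div, mul_div_assoc', le_div_iff₀ ha]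
    nlinarith
  rw [abs_le]; constructor <;> linarith

/-- Multiplying the logarithms by `a` and `1 - a` turns their linear parts into `±P` and `±Q`, which
cancel. Only quadratic remainders survive, one order better than the bound on `t`. -/
lemma abs_tParam_mul_sub_le (ha : 0 < a) (ha' : a ≤ 3 / 4) (hP : |P| ≤ w) (hQ : |Q| ≤ w)
    (hw : w ≤ a / 8) :
    |tParam (a + P) (a + Q) * (a - lamParam (a + P) (a + Q))| ≤ 8 * (w ^ 2 / a) := by
  have h1a : 0 < 1 - a := by linarith
  have hw0 : 0 ≤ w := (abs_nonneg P).trans hP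
  obtain ⟨p1, p2, p3, p4⟩ := abs_quotients ha ha' hP hw
  obtain ⟨q1, q2, q3, q4⟩ := abs_quotients ha ha' hQ hw
  obtain ⟨h, h'⟩ := log_div_parts ha ha' hP hQ hw
  by_cases ht : tParam (a + P) (a + Q) = 0
  · rw [ht, zero_mul, abs_zero]; positivity
  have hl : tParam (a + P) (a + Q) * lamParam (a + P) (a + Q) =
      1 / 2 * Real.log ((1 - (a + Q)) / (1 - (a + P))) := by
    rw [lamParam]; field_simp
  rw [h'] at hl
  have bd : ∀ {x y c : ℝ}, 0 < c → |x| ≤ 1 / 2 → |x| ≤ y / c →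
      |c * (Real.log (1 + x) - x)| ≤ 2 * (y ^ 2 / c) := by
    intro x y c hc hx hy
    rw [abs_mul, abs_of_pos hc]
    have h1 := abs_log_one_add_sub_le hx
    have h2 : x ^ 2 ≤ (y / c) ^ 2 := by rw [← sq_abs]; gcongr
    calc c * |Real.log (1 + x) - x| ≤ c * (2 * (y / c) ^ 2) := by gcongr; linarith
      _ = 2 * (y ^ 2 / c) := by field_simp
  have l1 := abs_le.1 (bd ha p1 p3)
  have l2 := abs_le.1 (bd h1a p2 p4)
  have l3 := abs_le.1 (bd ha q1 q3)
  have l4 := abs_le.1 (bd h1a q2 q4)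
  have hc : w ^ 2 / (1 - a) ≤ 3 * (w ^ 2 / a) := by
    rw [div_le_iff₀ h1a, mul_assoc, div_mul_eq_mul_div, mul_div_assoc', le_div_iff₀ ha]
    nlinarith [sq_nonneg w]
  have e : tParam (a + P) (a + Q) * (a - lamParam (a + P) (a + Q)) =
      1 / 2 * (a * (Real.log (1 + P / a) - P / a) - a * (Real.log (1 + Q / a) - Q / a)
        - (1 - a) * (Real.log (1 + -Q / (1 - a)) - -Q / (1 - a))
        + (1 - a) * (Real.log (1 + -P / (1 - a)) - -P / (1 - a))) := by
    have e1 : tParam (a + P) (a + Q) * (a - lamParam (a + P) (a + Q)) =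
      (2 * tParam (a + P) (a + Q)) * a / 2 - tParam (a + P) (a + Q) * lamParam (a + P) (a + Q) := by
      ring
    rw [e1, hl, h]
    field_simp
    ring
  rw [e, abs_le]; constructor <;> linarith

end scalar

/-- `|t λ|` is controlled even when `t = 0`. -/
lemma abs_tParam_mul_lamParam_le {p q w : ℝ} (hp : |p| ≤ w) (hq : |q| ≤ w) (hw : w ≤ 1 / 2) :
    |tParam p q * lamParam p q| ≤ 2 * w := by
  by_cases ht : tParam p q = 0
  · rw [ht, zero_mul, abs_zero]; linarith [abs_nonneg p]
  have hl : tParam p q * lamParam p q = 1 / 2 * Real.log ((1 - q) / (1 - p)) := by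
    rw [lamParam]; field_simp
  have lp := abs_log_one_add_le (x := -p) (by rw [abs_neg]; linarith)
  have lq := abs_log_one_add_le (x := -q) (by rw [abs_neg]; linarith)
  rw [abs_neg, ← sub_eq_add_neg] at lp lq
  rw [hl, Real.log_div (by linarith [abs_le.1 hq]) (by linarith [abs_le.1 hp])]
  have l1 := abs_le.1 lp
  have l2 := abs_le.1 lq
  rw [abs_le]; constructor <;> linarith

lemma tParam_complement (p q : ℝ) : tParam (1 - p) (1 - q) = -tParam p q := by
  rw [tParam, tParam, ← mul_neg, ← Real.log_inv]
  congr 2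
  rw [inv_div]; ring_nf

/-- Exchanging edges and non-edges sends `t` to `-t` and `λ` to `1 - λ`; the factor `t` makes this
true also where `λ` is undefined. -/
lemma tParam_mul_lamParam_complement (p q : ℝ) :
    tParam p q * (1 - lamParam (1 - p) (1 - q)) = tParam p q * lamParam p q := by
  by_cases ht : tParam p q = 0
  · simp [ht]
  -- As `log 0 = 0`, a nonzero `t` forces all four factors to be nonzero, which is all that
  -- splitting the logarithms needs.
  have hne : p * (1 - q) / (q * (1 - p)) ≠ 0 := by
    intro h; apply ht; rw [tParam, h]; simp
  obtain ⟨h1, h2⟩ := div_ne_zero_iff.1 hne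
  obtain ⟨hp, hq'⟩ := mul_ne_zero_iff.1 h1
  obtain ⟨hq, hp'⟩ := mul_ne_zero_iff.1 h2
  have e : 2 * tParam p q = Real.log p + Real.log (1 - q) - (Real.log q + Real.log (1 - p)) := by
    rw [tParam, Real.log_div h1 h2, Real.log_mul hp hq', Real.log_mul hq hp']; ring
  rw [lamParam, lamParam, tParam_complement, sub_sub_cancel, sub_sub_cancel,
    Real.log_div hq hp, Real.log_div hq' hp']
  field_simp
  linarith

/-! ### Quadratic forms and the algebra of one update -/

section
variable {n : ℕ}

/-- The Euclidean norm of a vector given as a function. -/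
def l2 (v : Fin n → ℝ) : ℝ := ‖WithLp.toLp 2 v‖

lemma l2_nonneg (v : Fin n → ℝ) : 0 ≤ l2 v := norm_nonneg _

lemma l2_sq (v : Fin n → ℝ) : l2 v ^ 2 = ∑ i, v i ^ 2 := by
  rw [l2, EuclideanSpace.norm_sq_eq]; simp

lemma l2_add_le (v w : Fin n → ℝ) : l2 (v + w) ≤ l2 v + l2 w := by
  rw [l2, WithLp.toLp_add]; exact norm_add_le _ _

lemma l2_smul (c : ℝ) (v : Fin n → ℝ) : l2 (c • v) = |c| * l2 v := by
  rw [l2, WithLp.toLp_smul, norm_smul, Real.norm_eq_abs, l2]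

lemma l2_le_of_sq_le {v : Fin n → ℝ} {c : ℝ} (hc : 0 ≤ c) (h : ∑ i, v i ^ 2 ≤ c ^ 2) : l2 v ≤ c := by
  rw [← l2_sq] at h
  exact le_of_sq_le_sq h hc

lemma l2_mono {v w : Fin n → ℝ} (h : ∀ i, |v i| ≤ |w i|) : l2 v ≤ l2 w := by
  apply l2_le_of_sq_le (l2_nonneg _)
  rw [l2_sq]
  exact Finset.sum_le_sum fun i _ => sq_le_sq.2 (h i)

lemma l2_le_of_abs_le {v : Fin n → ℝ} {c : ℝ} (hc : 0 ≤ c) (h : ∀ i, |v i| ≤ c) :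
    l2 v ≤ c * √n := by
  apply l2_le_of_sq_le (by positivity)
  calc ∑ i, v i ^ 2 ≤ ∑ _i : Fin n, c ^ 2 :=
        Finset.sum_le_sum fun i _ => sq_le_sq.2 (by rw [abs_of_nonneg hc]; exact h i)
    _ = (c * √n) ^ 2 := by
        rw [mul_pow, Real.sq_sqrt (by positivity)]; simp [mul_comm]

lemma abs_dotProduct_le (v w : Fin n → ℝ) : |v ⬝ᵥ w| ≤ l2 v * l2 w := by
  apply abs_le_of_sq_le_sq _ (mul_nonneg (l2_nonneg _) (l2_nonneg _))
  rw [mul_pow, l2_sq, l2_sq]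
  exact Finset.sum_mul_sq_le_sq_mul_sq _ _ _

lemma abs_sum_le_l2 (v : Fin n → ℝ) : |∑ i, v i| ≤ √n * l2 v := by
  have h := abs_dotProduct_le (fun _ => 1) v
  have h1 : l2 (fun _ : Fin n => (1 : ℝ)) ≤ 1 * √n := l2_le_of_abs_le zero_le_one (by simp)
  simp only [dotProduct, one_mul] at h h1
  exact h.trans (by gcongr; exact l2_nonneg _)

lemma offDiag_mulVec (u : Fin n → ℝ) (i : Fin n) : (offDiag n *ᵥ u) i = ∑ j, u j - u i := by
  rw [offDiag, Matrix.sub_mulVec, Matrix.one_mulVec]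
  simp [Matrix.mulVec, dotProduct]

lemma offDiag_apply (i j : Fin n) : offDiag n i j = if i = j then 0 else 1 := by
  by_cases h : i = j <;> simp [offDiag, h]

lemma l2_offDiag_mulVec_le (u : Fin n → ℝ) : l2 (offDiag n *ᵥ u) ≤ 2 * (n * l2 u) := by
  rcases Nat.eq_zero_or_pos n with rfl | hn
  · rw [show l2 (offDiag 0 *ᵥ u) = 0 by rw [l2]; simp [Subsingleton.elim (offDiag 0 *ᵥ u) 0]]
    simp
  have e : offDiag n *ᵥ u = (fun _ => ∑ j, u j) + (-1 : ℝ) • u := by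
    ext i; rw [offDiag_mulVec]; simp; ring
  rw [e]
  refine (l2_add_le _ _).trans ?_
  have h1 : l2 (fun _ : Fin n => ∑ j, u j) ≤ |∑ j, u j| * √n :=
    l2_le_of_abs_le (abs_nonneg _) fun _ => le_rfl
  have h2 : |∑ j, u j| * √n ≤ n * l2 u := by
    calc _ ≤ √n * l2 u * √n := by gcongr; exact abs_sum_le_l2 u
      _ = (√n * √n) * l2 u := by ring
      _ = n * l2 u := by rw [Real.mul_self_sqrt (by positivity)]
  have h3 : l2 ((-1 : ℝ) • u) = l2 u := by rw [l2_smul]; simp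
  have hn1 : (1 : ℝ) ≤ n := by exact_mod_cast hn
  nlinarith [l2_nonneg u]

lemma offDiag_quad (u : Fin n → ℝ) :
    u ⬝ᵥ offDiag n *ᵥ u = (∑ i, u i) ^ 2 - ∑ i, u i ^ 2 := by
  simp only [dotProduct, offDiag_mulVec, mul_sub, Finset.sum_sub_distrib, ← Finset.sum_mul]
  simp [sq]

lemma sum_offDiag : ∑ i, ∑ j, offDiag n i j = n * (n - 1) := by
  have h : ∀ i : Fin n, ∑ j, offDiag n i j = n - 1 := by
    intro i
    have := offDiag_mulVec (fun _ : Fin n => (1 : ℝ)) i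
    simpa [Matrix.mulVec, dotProduct] using this
  simp [h]; ring

lemma offDiag_isSymm : (offDiag n).IsSymm := by
  ext i j
  simp [Matrix.transpose_apply, offDiag_apply, eq_comm]

/-- The Cauchy-Schwarz bound of `‖M u‖` by the Frobenius norm. -/
lemma l2_mulVec_le (M : Matrix (Fin n) (Fin n) ℝ) (u : Fin n → ℝ) :
    l2 (M *ᵥ u) ≤ √(∑ i, ∑ j, M i j ^ 2) * l2 u := by
  apply l2_le_of_sq_le (mul_nonneg (Real.sqrt_nonneg _) (l2_nonneg _))
  rw [mul_pow, Real.sq_sqrt (by positivity), l2_sq, Finset.sum_mul]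
  refine Finset.sum_le_sum fun i _ => ?_
  simp only [Matrix.mulVec, dotProduct]
  exact Finset.sum_mul_sq_le_sq_mul_sq _ _ _

/-- The Schur test for a symmetric matrix with nonnegative entries and bounded row sums. -/
lemma l2_mulVec_le_of_row_sum_le {A : Matrix (Fin n) (Fin n) ℝ} (hs : A.IsSymm)
    (h0 : ∀ i j, 0 ≤ A i j) {D : ℝ} (hD : 0 ≤ D) (hd : ∀ i, ∑ j, A i j ≤ D) (u : Fin n → ℝ) :
    l2 (A *ᵥ u) ≤ D * l2 u := by
  apply l2_le_of_sq_le (mul_nonneg hD (l2_nonneg _))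
  rw [mul_pow, l2_sq]
  have h : ∀ i, (A *ᵥ u) i ^ 2 ≤ D * ∑ j, A i j * u j ^ 2 := by
    intro i
    have hcs := Finset.sum_mul_sq_le_sq_mul_sq Finset.univ (fun j => √(A i j))
      (fun j => √(A i j) * u j)
    have e1 : ∀ j, √(A i j) * (√(A i j) * u j) = A i j * u j := fun j => by
      rw [← mul_assoc, Real.mul_self_sqrt (h0 i j)]
    simp only [e1, mul_pow, Real.sq_sqrt (h0 i _)] at hcs
    refine hcs.trans ?_
    gcongr
    · exact Finset.sum_nonneg fun j _ => mul_nonneg (h0 i j) (sq_nonneg _)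
    · exact hd i
  calc ∑ i, (A *ᵥ u) i ^ 2 ≤ ∑ i, D * ∑ j, A i j * u j ^ 2 := Finset.sum_le_sum fun i _ => h i
    _ = D * ∑ j, (∑ i, A j i) * u j ^ 2 := by
        rw [← Finset.mul_sum, Finset.sum_comm]
        congr 1
        refine Finset.sum_congr rfl fun j _ => ?_
        rw [Finset.sum_mul]
        exact Finset.sum_congr rfl fun i _ => by rw [hs.apply]
    _ ≤ D * ∑ j, D * u j ^ 2 := by
        gcongr with j; exact hd j
    _ = _ := by rw [← Finset.mul_sum]; ring

/-- The vector `ψ - (1/2) 𝟏`. -/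
def centerHalf (ψ : Fin n → ℝ) : Fin n → ℝ := ψ - fun _ => 1 / 2

lemma distHalf_eq (ψ : Fin n → ℝ) : distHalf ψ = l2 (centerHalf ψ) := rfl

/-- The edge density of a network. -/
def density (A : Matrix (Fin n) (Fin n) ℝ) : ℝ := (∑ i, ∑ j, A i j) / (n * (n - 1))

/-- The adjacency matrix minus its mean off-diagonal entry. -/
def centered (A : Matrix (Fin n) (Fin n) ℝ) : Matrix (Fin n) (Fin n) ℝ :=
  A - density A • offDiag n

lemma symm_dotProduct {B : Matrix (Fin n) (Fin n) ℝ} (hB : B.IsSymm) (v w : Fin n → ℝ) :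
    v ⬝ᵥ B *ᵥ w = w ⬝ᵥ B *ᵥ v := by
  rw [Matrix.dotProduct_mulVec, ← Matrix.mulVec_transpose, hB.eq, dotProduct_comm]

lemma half_quad (B : Matrix (Fin n) (Fin n) ℝ) :
    (fun _ => 1 / 2 : Fin n → ℝ) ⬝ᵥ B *ᵥ (fun _ => 1 / 2) = (∑ i, ∑ j, B i j) / 4 := by
  simp only [dotProduct, Matrix.mulVec, ← Finset.sum_mul, ← Finset.mul_sum]
  ring

/-- With `ψ = 1/2 + u` and `1 - ψ = 1/2 - u`, the mixed terms of the two forms cancel. -/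
lemma within_quad (B : Matrix (Fin n) (Fin n) ℝ) (ψ : Fin n → ℝ) :
    ψ ⬝ᵥ B *ᵥ ψ + (1 - ψ) ⬝ᵥ B *ᵥ (1 - ψ) =
      (∑ i, ∑ j, B i j) / 2 + 2 * (centerHalf ψ ⬝ᵥ B *ᵥ centerHalf ψ) := by
  have e1 : ψ = centerHalf ψ + fun _ => 1 / 2 := by simp [centerHalf]
  have e2 : 1 - ψ = (fun _ => 1 / 2) - centerHalf ψ := by
    ext i; simp [centerHalf]; ring
  have h := half_quad B
  rw [e2]
  nth_rw 1 2 [e1]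
  simp only [Matrix.mulVec_add, Matrix.mulVec_sub, dotProduct_add, dotProduct_sub, add_dotProduct,
    sub_dotProduct]
  linarith

/-- Here the mixed terms cancel only because `B` is symmetric. -/
lemma between_quad {B : Matrix (Fin n) (Fin n) ℝ} (hB : B.IsSymm) (ψ : Fin n → ℝ) :
    ψ ⬝ᵥ B *ᵥ (1 - ψ) =
      (∑ i, ∑ j, B i j) / 4 - centerHalf ψ ⬝ᵥ B *ᵥ centerHalf ψ := by
  have e1 : ψ = centerHalf ψ + fun _ => 1 / 2 := by simp [centerHalf]
  have e2 : 1 - ψ = (fun _ => 1 / 2) - centerHalf ψ := by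
    ext i; simp [centerHalf]; ring
  have h := half_quad B
  have h2 := symm_dotProduct hB (centerHalf ψ) (fun _ => 1 / 2)
  rw [e2]
  nth_rw 1 [e1]
  simp only [Matrix.mulVec_sub, dotProduct_sub, add_dotProduct]
  linarith

/-- The quadratic form of `B` at `ψ - (1/2) 𝟏`, times `4 / (n (n - 1))`. -/
def normQuad (B : Matrix (Fin n) (Fin n) ℝ) (ψ : Fin n → ℝ) : ℝ :=
  4 * (centerHalf ψ ⬝ᵥ B *ᵥ centerHalf ψ) / (n * (n - 1))

lemma quad_eq (hn : 2 ≤ n) (A : Matrix (Fin n) (Fin n) ℝ) (ψ : Fin n → ℝ) :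
    4 * (centerHalf ψ ⬝ᵥ A *ᵥ centerHalf ψ) =
      n * (n - 1) * (normQuad (centered A) ψ + density A * normQuad (offDiag n) ψ) := by
  have hn' : (2 : ℝ) ≤ n := by exact_mod_cast hn
  have : (n : ℝ) * (n - 1) ≠ 0 := by apply mul_ne_zero <;> linarith
  have h1 : (n : ℝ) - 1 ≠ 0 := by linarith
  simp only [normQuad, centered, Matrix.sub_mulVec, Matrix.smul_mulVec, dotProduct_sub,
    dotProduct_smul, smul_eq_mul]
  field_simp
  ring

lemma total_eq (hn : 2 ≤ n) (A : Matrix (Fin n) (Fin n) ℝ) :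
    ∑ i, ∑ j, A i j = n * (n - 1) * density A := by
  have hn' : (2 : ℝ) ≤ n := by exact_mod_cast hn
  have : (n : ℝ) * (n - 1) ≠ 0 := by apply mul_ne_zero <;> linarith
  rw [density, mul_div_cancel₀ _ this]

lemma offDiag_normQuad (hn : 2 ≤ n) (ψ : Fin n → ℝ) :
    4 * (centerHalf ψ ⬝ᵥ offDiag n *ᵥ centerHalf ψ) = n * (n - 1) * normQuad (offDiag n) ψ := by
  have hn' : (2 : ℝ) ≤ n := by exact_mod_cast hn
  have : (n : ℝ) * (n - 1) ≠ 0 := by apply mul_ne_zero <;> linarith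
  rw [normQuad, mul_div_cancel₀ _ this]

/-- Subtracting `a(J - I)` from `A` makes the total sum vanish, so the deviation of the ratio from
`a` comes from the quadratic form alone. -/
lemma pUpdate_eq (hn : 2 ≤ n) (A : Matrix (Fin n) (Fin n) ℝ) (ψ : Fin n → ℝ)
    (hU : 1 + normQuad (offDiag n) ψ ≠ 0) :
    pUpdate A ψ = density A + normQuad (centered A) ψ / (1 + normQuad (offDiag n) ψ) := by
  have hn' : (2 : ℝ) ≤ n := by exact_mod_cast hn
  have hD : (n : ℝ) * (n - 1) ≠ 0 := by apply mul_ne_zero <;> linarith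
  rw [pUpdate, within_quad, within_quad, sum_offDiag, total_eq hn A]
  have h1 := quad_eq hn A ψ
  have h2 := offDiag_normQuad hn ψ
  generalize centerHalf ψ ⬝ᵥ A *ᵥ centerHalf ψ = x at *
  generalize centerHalf ψ ⬝ᵥ offDiag n *ᵥ centerHalf ψ = y at *
  have hx : x = n * (n - 1) * (normQuad (centered A) ψ + density A * normQuad (offDiag n) ψ) / 4 := by
    linarith
  have hy : y = n * (n - 1) * normQuad (offDiag n) ψ / 4 := by linarith
  rw [hx, hy]
  generalize (n : ℝ) * (n - 1) = D at *
  have : D / 2 + 2 * (D * normQuad (offDiag n) ψ / 4) = D / 2 * (1 + normQuad (offDiag n) ψ) := by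
    ring
  rw [this]
  field_simp
  ring

lemma qUpdate_eq (hn : 2 ≤ n) {A : Matrix (Fin n) (Fin n) ℝ} (hA : A.IsSymm) (ψ : Fin n → ℝ)
    (hU : 1 - normQuad (offDiag n) ψ ≠ 0) :
    qUpdate A ψ = density A + -normQuad (centered A) ψ / (1 - normQuad (offDiag n) ψ) := by
  have hn' : (2 : ℝ) ≤ n := by exact_mod_cast hn
  have hD : (n : ℝ) * (n - 1) ≠ 0 := by apply mul_ne_zero <;> linarith
  rw [qUpdate, between_quad hA, between_quad offDiag_isSymm, sum_offDiag, total_eq hn A]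
  have h1 := quad_eq hn A ψ
  have h2 := offDiag_normQuad hn ψ
  generalize centerHalf ψ ⬝ᵥ A *ᵥ centerHalf ψ = x at *
  generalize centerHalf ψ ⬝ᵥ offDiag n *ᵥ centerHalf ψ = y at *
  have hx : x = n * (n - 1) * (normQuad (centered A) ψ + density A * normQuad (offDiag n) ψ) / 4 := by
    linarith
  have hy : y = n * (n - 1) * normQuad (offDiag n) ψ / 4 := by linarith
  rw [hx, hy]
  generalize (n : ℝ) * (n - 1) = D at *
  have : D / 4 - (D * normQuad (offDiag n) ψ / 4) = D / 4 * (1 - normQuad (offDiag n) ψ) := by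
    ring
  rw [this]
  field_simp
  ring

/-- The centre `a` is free: the density is used for the expansion, `0` for isolated vertices, and
`1` against `0` for complementary graphs. -/
lemma xiUpdate_eq (A : Matrix (Fin n) (Fin n) ℝ) (ψ : Fin n → ℝ) (a : ℝ) :
    xiUpdate A ψ = (4 * tParam (pUpdate A ψ) (qUpdate A ψ)) • ((A - a • offDiag n) *ᵥ centerHalf ψ) +
      (4 * (tParam (pUpdate A ψ) (qUpdate A ψ) * (a - lamParam (pUpdate A ψ) (qUpdate A ψ)))) •
        (offDiag n *ᵥ centerHalf ψ) := by
  ext i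
  simp only [xiUpdate, Matrix.sub_mulVec, Matrix.smul_mulVec, Pi.add_apply, Pi.smul_apply,
    Pi.sub_apply, smul_eq_mul, centerHalf]
  ring

lemma pUpdate_complement {A : Matrix (Fin n) (Fin n) ℝ} {ψ : Fin n → ℝ}
    (h : ψ ⬝ᵥ offDiag n *ᵥ ψ + (1 - ψ) ⬝ᵥ offDiag n *ᵥ (1 - ψ) ≠ 0) :
    pUpdate (offDiag n - A) ψ = 1 - pUpdate A ψ := by
  rw [pUpdate, pUpdate, eq_sub_iff_add_eq, ← add_div]
  convert div_self h using 2
  simp only [Matrix.sub_mulVec, dotProduct_sub]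
  ring

lemma qUpdate_complement {A : Matrix (Fin n) (Fin n) ℝ} {ψ : Fin n → ℝ}
    (h : ψ ⬝ᵥ offDiag n *ᵥ (1 - ψ) ≠ 0) :
    qUpdate (offDiag n - A) ψ = 1 - qUpdate A ψ := by
  rw [qUpdate, qUpdate, eq_sub_iff_add_eq, ← add_div]
  convert div_self h using 2
  simp only [Matrix.sub_mulVec, dotProduct_sub]
  ring

/-- Passing to the complementary network does not change the update. -/
lemma psiUpdate_complement (hn : 2 ≤ n) (A : Matrix (Fin n) (Fin n) ℝ) {ψ : Fin n → ℝ}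
    (hU : |normQuad (offDiag n) ψ| < 1) : psiUpdate (offDiag n - A) ψ = psiUpdate A ψ := by
  have hn' : (2 : ℝ) ≤ n := by exact_mod_cast hn
  have hD : 0 < (n : ℝ) * (n - 1) := by apply mul_pos <;> linarith
  have h2 := offDiag_normQuad hn ψ
  obtain ⟨hU1, hU2⟩ := abs_lt.1 hU
  have hp : ψ ⬝ᵥ offDiag n *ᵥ ψ + (1 - ψ) ⬝ᵥ offDiag n *ᵥ (1 - ψ) ≠ 0 := by
    rw [within_quad, sum_offDiag]
    have : 0 < (n : ℝ) * (n - 1) * (1 + normQuad (offDiag n) ψ) := by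
      apply mul_pos hD; linarith
    intro h; nlinarith
  have hq : ψ ⬝ᵥ offDiag n *ᵥ (1 - ψ) ≠ 0 := by
    rw [between_quad offDiag_isSymm, sum_offDiag]
    have : 0 < (n : ℝ) * (n - 1) * (1 - normQuad (offDiag n) ψ) := by
      apply mul_pos hD; linarith
    intro h; nlinarith
  ext i
  rw [psiUpdate, psiUpdate]
  congr 1
  rw [xiUpdate_eq (offDiag n - A) ψ 1, xiUpdate_eq A ψ 0, pUpdate_complement hp,
    qUpdate_complement hq, tParam_complement]
  have := tParam_mul_lamParam_complement (pUpdate A ψ) (qUpdate A ψ)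
  simp only [Matrix.sub_mulVec, Matrix.smul_mulVec, Pi.add_apply, Pi.smul_apply,
    Pi.sub_apply, smul_eq_mul]
  linear_combination (-4 * (offDiag n *ᵥ centerHalf ψ) i) * this

end

/-! ### Deterministic bounds for one update -/

section
variable {n : ℕ}

/-- Adjacency matrices of simple graphs, with real entries. -/
structure IsAdjacency (A : Matrix (Fin n) (Fin n) ℝ) : Prop where
  zero_or_one : ∀ i j, A i j = 0 ∨ A i j = 1
  symm : A.IsSymm
  diag : ∀ i, A i i = 0

namespace IsAdjacency
variable {A : Matrix (Fin n) (Fin n) ℝ}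

lemma nonneg (hA : IsAdjacency A) (i j : Fin n) : 0 ≤ A i j := by
  rcases hA.zero_or_one i j with h | h <;> simp [h]

lemma sq_eq (hA : IsAdjacency A) (i j : Fin n) : A i j ^ 2 = A i j := by
  rcases hA.zero_or_one i j with h | h <;> simp [h]

lemma mul_offDiag (hA : IsAdjacency A) (i j : Fin n) : A i j * offDiag n i j = A i j := by
  rw [offDiag_apply]
  split_ifs with h
  · subst h; simp [hA.diag]
  · simp

lemma complement (hA : IsAdjacency A) : IsAdjacency (offDiag n - A) where
  zero_or_one i j := by
    by_cases h : i = j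
    · subst h; left; simp [offDiag_apply, hA.diag]
    · rcases hA.zero_or_one i j with h' | h' <;> simp [offDiag_apply, h, h']
  symm := offDiag_isSymm.sub hA.symm
  diag i := by simp [offDiag_apply, hA.diag]

lemma density_complement (hn : 2 ≤ n) (A : Matrix (Fin n) (Fin n) ℝ) :
    density (offDiag n - A) = 1 - density A := by
  have hn' : (2 : ℝ) ≤ n := by exact_mod_cast hn
  have hD : (n : ℝ) * (n - 1) ≠ 0 := by apply mul_ne_zero <;> linarith
  have h := sum_offDiag (n := n)
  simp only [density, Matrix.sub_apply, Finset.sum_sub_distrib, h]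
  rw [sub_div, div_self hD]

lemma density_nonneg (hn : 2 ≤ n) (hA : IsAdjacency A) : 0 ≤ density A := by
  have hn' : (2 : ℝ) ≤ n := by exact_mod_cast hn
  have hD : 0 < (n : ℝ) * (n - 1) := by apply mul_pos <;> linarith
  exact div_nonneg (Finset.sum_nonneg fun i _ => Finset.sum_nonneg fun j _ => hA.nonneg i j) hD.le

/-- For `0`-`1` entries the sum is exactly `n(n-1)a(1-a)`. -/
lemma frobenius_centered (hn : 2 ≤ n) (hA : IsAdjacency A) :
    ∑ i, ∑ j, centered A i j ^ 2 ≤ (n * √(density A)) ^ 2 := by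
  have hn' : (2 : ℝ) ≤ n := by exact_mod_cast hn
  have ha := hA.density_nonneg hn
  have e : ∀ i j, centered A i j ^ 2 =
      (1 - 2 * density A) * A i j + density A ^ 2 * offDiag n i j := by
    intro i j
    have h1 := hA.sq_eq i j
    have h2 := hA.mul_offDiag i j
    have h3 : offDiag n i j ^ 2 = offDiag n i j := by rw [offDiag_apply]; split_ifs <;> simp
    simp only [centered, Matrix.sub_apply, Matrix.smul_apply, smul_eq_mul]
    linear_combination h1 - 2 * density A * h2 + density A ^ 2 * h3
  simp only [e, Finset.sum_add_distrib, ← Finset.mul_sum, sum_offDiag, total_eq hn A]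
  rw [mul_pow, Real.sq_sqrt ha]
  have : 0 ≤ (n : ℝ) * (n - 1) * density A ^ 2 := by
    apply mul_nonneg (mul_nonneg _ _) (sq_nonneg _) <;> linarith
  nlinarith

end IsAdjacency

lemma normQuad_offDiag_le (hn : 2 ≤ n) (ψ : Fin n → ℝ) :
    |normQuad (offDiag n) ψ| ≤ 4 * l2 (centerHalf ψ) ^ 2 * (2 / (n - 1)) := by
  have hn' : (2 : ℝ) ≤ n := by exact_mod_cast hn
  have hD : 0 < (n : ℝ) * (n - 1) := by apply mul_pos <;> linarith
  have h := abs_dotProduct_le (centerHalf ψ) (offDiag n *ᵥ centerHalf ψ)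
  have h2 := l2_offDiag_mulVec_le (centerHalf ψ)
  have h0 := l2_nonneg (centerHalf ψ)
  have hn1 : (n : ℝ) - 1 ≠ 0 := by linarith
  rw [normQuad, abs_div, abs_of_pos hD, abs_mul, abs_of_pos (by norm_num : (0 : ℝ) < 4)]
  calc _ ≤ 4 * (l2 (centerHalf ψ) * (2 * (n * l2 (centerHalf ψ)))) / (n * (n - 1)) := by
        gcongr; exact h.trans (by gcongr)
    _ = _ := by field_simp

lemma abs_normQuad_le (hn : 2 ≤ n) (B : Matrix (Fin n) (Fin n) ℝ) (ψ : Fin n → ℝ) {x : ℝ}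
    (h : |centerHalf ψ ⬝ᵥ B *ᵥ centerHalf ψ| ≤ x * n) : |normQuad B ψ| ≤ 8 * x / n := by
  have hn' : (2 : ℝ) ≤ n := by exact_mod_cast hn
  have hD : 0 < (n : ℝ) * (n - 1) := by apply mul_pos <;> linarith
  have hx : 0 ≤ x := by
    by_contra hx
    have := (abs_nonneg _).trans h
    nlinarith
  rw [normQuad, abs_div, abs_of_pos hD, abs_mul, abs_of_pos (by norm_num : (0 : ℝ) < 4),
    div_le_div_iff₀ hD (by linarith)]
  nlinarith [mul_nonneg hx (by positivity : (0 : ℝ) ≤ (n : ℝ) * n)]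

section step
variable {A : Matrix (Fin n) (Fin n) ℝ} {ψ : Fin n → ℝ} {η w : ℝ}

/-- The margin `η` keeps both denominators `1 ± U` at least `η`. -/
lemma pq_update_eq (hn : 2 ≤ n) (hA : A.IsSymm) (hη : 0 < η)
    (hU : |normQuad (offDiag n) ψ| ≤ 1 - η) (hw : |normQuad (centered A) ψ| ≤ w * η) :
    ∃ P Q : ℝ, |P| ≤ w ∧ |Q| ≤ w ∧ pUpdate A ψ = density A + P ∧ qUpdate A ψ = density A + Q := by
  obtain ⟨h1, h2⟩ := abs_le.1 hU
  have hw0 : 0 ≤ w := by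
    have := (abs_nonneg _).trans hw
    exact nonneg_of_mul_nonneg_left this hη
  refine ⟨_, _, ?_, ?_, pUpdate_eq hn A ψ (by linarith), qUpdate_eq hn hA ψ (by linarith)⟩
  · rw [abs_div, abs_of_pos (by linarith : 0 < 1 + normQuad (offDiag n) ψ),
      div_le_iff₀ (by linarith)]
    exact hw.trans (by gcongr; linarith)
  · rw [abs_div, abs_neg, abs_of_pos (by linarith : 0 < 1 - normQuad (offDiag n) ψ),
      div_le_iff₀ (by linarith)]
    exact hw.trans (by gcongr; linarith)

lemma centerHalf_psiUpdate (A : Matrix (Fin n) (Fin n) ℝ) (ψ : Fin n → ℝ) (i : Fin n) :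
    centerHalf (psiUpdate A ψ) i = Real.sigmoid (xiUpdate A ψ i) - 1 / 2 := rfl

lemma abs_centerHalf_psiUpdate_le (A : Matrix (Fin n) (Fin n) ℝ) (ψ : Fin n → ℝ) (i : Fin n) :
    |centerHalf (psiUpdate A ψ) i| ≤ 1 / 2 := abs_sigmoid_sub_half_le_half _

/-- The bound of one update when the estimated probabilities are close to the edge density. -/
lemma l2_psiUpdate_le (hn : 2 ≤ n) (hA : A.IsSymm) (hη : 0 < η)
    (hU : |normQuad (offDiag n) ψ| ≤ 1 - η) (hw : |normQuad (centered A) ψ| ≤ w * η)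
    (ha : 0 < density A) (ha' : density A ≤ 3 / 4) (hwa : w ≤ density A / 8) :
    l2 (centerHalf (psiUpdate A ψ)) ≤ 32 * (w / density A) * l2 (centered A *ᵥ centerHalf ψ) +
      64 * (w ^ 2 / density A) * (n * l2 (centerHalf ψ)) := by
  obtain ⟨P, Q, hP, hQ, hp, hq⟩ := pq_update_eq hn hA hη hU hw
  have h1 : l2 (centerHalf (psiUpdate A ψ)) ≤ l2 (xiUpdate A ψ) :=
    l2_mono fun i => abs_sigmoid_sub_half_le _
  have ht := abs_tParam_le ha ha' hP hQ hwa
  have hl := abs_tParam_mul_sub_le ha ha' hP hQ hwa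
  have h2 := l2_offDiag_mulVec_le (centerHalf ψ)
  have h0 : 0 ≤ w ^ 2 / density A := by positivity
  refine h1.trans ?_
  rw [xiUpdate_eq A ψ (density A), hp, hq]
  refine (l2_add_le _ _).trans ?_
  rw [l2_smul, l2_smul, abs_mul, abs_mul 4 (_ * _), abs_of_pos (by norm_num : (0 : ℝ) < 4)]
  apply add_le_add
  · apply mul_le_mul_of_nonneg_right _ (l2_nonneg _)
    linarith
  · calc _ ≤ 4 * (8 * (w ^ 2 / density A)) * (2 * (n * l2 (centerHalf ψ))) := by
          gcongr
          exact l2_nonneg _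
      _ = _ := by ring

/-- The bound of one update for networks with few edges. -/
lemma l2_psiUpdate_le_of_sparse (hA : IsAdjacency A) (hψ : ∀ i, |centerHalf ψ i| ≤ 1 / 2)
    (hp : |pUpdate A ψ| ≤ w) (hq : |qUpdate A ψ| ≤ w) (hw : w ≤ 1 / 2) :
    l2 (centerHalf (psiUpdate A ψ)) ^ 2 ≤ ∑ i, ∑ j, A i j + n * (8 * w * n) ^ 2 := by
  have hw0 : 0 ≤ w := (abs_nonneg _).trans hp
  have key : ∀ i, centerHalf (psiUpdate A ψ) i ^ 2 ≤ ∑ j, A i j + (8 * w * n) ^ 2 := by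
    intro i
    -- A vertex with an edge moves by at most `1/2`, which its degree pays for. At an isolated
    -- vertex only the term with `tλ` remains, and this is small without any lower bound on `p` and
    -- `q`.
    by_cases h : ∃ j, A i j = 1
    · obtain ⟨j, hj⟩ := h
      have h1 : (1 : ℝ) ≤ ∑ j, A i j := by
        rw [← hj]; exact Finset.single_le_sum (fun k _ => hA.nonneg i k) (Finset.mem_univ j)
      have h2 := abs_le.1 (abs_centerHalf_psiUpdate_le A ψ i)
      nlinarith [sq_nonneg (8 * w * n)]
    · have h0 : ∀ j, A i j = 0 := fun j => (hA.zero_or_one i j).resolve_right fun h' => h ⟨j, h'⟩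
      have e : xiUpdate A ψ i = -4 * (tParam (pUpdate A ψ) (qUpdate A ψ) *
          lamParam (pUpdate A ψ) (qUpdate A ψ)) * (offDiag n *ᵥ centerHalf ψ) i := by
        have h3 : (A *ᵥ centerHalf ψ) i = 0 := by simp [Matrix.mulVec, dotProduct, h0]
        rw [xiUpdate_eq A ψ 0]
        simp only [Matrix.sub_mulVec, Matrix.smul_mulVec, Pi.add_apply, Pi.smul_apply,
          Pi.sub_apply, smul_eq_mul, h3]
        ring
      have ht := abs_tParam_mul_lamParam_le hp hq hw
      have hu : |(offDiag n *ᵥ centerHalf ψ) i| ≤ n := by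
        have h5 : |∑ j, centerHalf ψ j| ≤ n * (1 / 2) := by
          refine (Finset.abs_sum_le_sum_abs _ _).trans ?_
          refine (Finset.sum_le_sum fun j _ => hψ j).trans ?_
          simp
        have h6 : (1 : ℝ) ≤ n := by exact_mod_cast (Fin.pos i)
        rw [offDiag_mulVec]
        have h7 := abs_le.1 h5
        have h8 := abs_le.1 (hψ i)
        rw [abs_le]; constructor <;> linarith
      have h9 : |xiUpdate A ψ i| ≤ 8 * w * n := by
        rw [e, abs_mul, abs_mul]
        calc _ ≤ |(-4 : ℝ)| * (2 * w) * n := by gcongr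
          _ = 8 * w * n := by rw [abs_neg, abs_of_pos (by norm_num : (0 : ℝ) < 4)]; ring
      have h10 := (abs_sigmoid_sub_half_le (xiUpdate A ψ i)).trans h9
      simp only [h0, Finset.sum_const_zero, zero_add]
      rw [centerHalf_psiUpdate]
      exact sq_le_sq' (by linarith [abs_le.1 h10]) (abs_le.1 h10).2
  rw [l2_sq]
  refine (Finset.sum_le_sum fun i _ => key i).trans ?_
  rw [Finset.sum_add_distrib]; simp

/-- The edge sum is at most `T`, and the `n` possible isolated vertices contribute at most `n(8T/n)²
≤ 64T²` together. -/
lemma l2_psiUpdate_le_of_few_edges {T : ℝ} (hn : 2 ≤ n) (hA : IsAdjacency A)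
    (hψ : ∀ i, |centerHalf ψ i| ≤ 1 / 2) (hw : 0 ≤ w) (hp : |pUpdate A ψ| ≤ density A + w)
    (hq : |qUpdate A ψ| ≤ density A + w) (hT : 1 ≤ T) (hTn : 2 * T ≤ n)
    (h : n ^ 2 * (density A + w) ≤ T) : l2 (centerHalf (psiUpdate A ψ)) ≤ T + 8 * T := by
  have hn' : (2 : ℝ) ≤ n := by exact_mod_cast hn
  have hn0 : (0 : ℝ) < n := by linarith
  have hnn : 0 < (n : ℝ) ^ 2 := by positivity
  have ha0 := hA.density_nonneg hn
  have hdw' : density A + w ≤ T / n ^ 2 := by rw [le_div_iff₀ hnn]; linarith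
  have hT2 : T / n ^ 2 ≤ 1 / 2 := by rw [div_le_iff₀ hnn]; nlinarith
  have hsp := l2_psiUpdate_le_of_sparse hA hψ (hp.trans hdw') (hq.trans hdw') hT2
  have hN : ∑ i, ∑ j, A i j ≤ T := by
    rw [total_eq hn]
    have h1 : (n : ℝ) * (n - 1) * density A ≤ n ^ 2 * density A := by
      gcongr; nlinarith
    have h2 : 0 ≤ (n : ℝ) ^ 2 * w := by positivity
    linarith
  have hN2 : (n : ℝ) * (8 * (T / n ^ 2) * n) ^ 2 ≤ 64 * T ^ 2 := by
    have e : (n : ℝ) * (8 * (T / n ^ 2) * n) ^ 2 = 64 * T ^ 2 / n := by field_simp; norm_num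
    rw [e]
    exact div_le_self (by positivity) (by linarith)
  apply le_of_sq_le_sq _ (by positivity)
  calc _ ≤ T + 64 * T ^ 2 := hsp.trans (add_le_add hN hN2)
    _ ≤ (T + 8 * T) ^ 2 := by nlinarith

end step

set_option maxHeartbeats 800000 in
-- The number `r` stands for the square root of the density, of `A` itself or of its mean, which is
-- why only closeness of `r ^ 2` to the density is assumed. The main regime gives `(w/a)‖Ãu‖ =
-- O(r²/a) = O(1)`, and the other regime forces `n r = O(1)`.
lemma step_bounded_of_density {K η : ℝ} (hK : 1 ≤ K) (hη : 0 < η) (hη1 : η ≤ 1) :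
    ∃ (C : ℝ) (n₀ : ℕ), 0 < C ∧ 2 ≤ n₀ ∧ ∀ n : ℕ, n₀ ≤ n → ∀ (A : Matrix (Fin n) (Fin n) ℝ)
      (ψ : Fin n → ℝ) (r : ℝ), IsAdjacency A → (∀ i, |centerHalf ψ i| ≤ 1 / 2) → 0 ≤ r →
      r ^ 2 ≤ 1 / 2 → |density A - r ^ 2| ≤ K * r / n →
      |centerHalf ψ ⬝ᵥ centered A *ᵥ centerHalf ψ| ≤ K * r * n →
      l2 (centered A *ᵥ centerHalf ψ) ≤ K * r * n →
      |normQuad (offDiag n) ψ| ≤ 1 - η → l2 (centerHalf (psiUpdate A ψ)) ≤ C := by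
  set R : ℝ := 65 * K / η with hR
  set T : ℝ := R ^ 2 + K * R + 8 * K * R / η with hT
  have hK0 : 0 < K := by linarith
  have hR0 : 0 < R := by positivity
  have hT0 : 0 < T := by positivity
  -- The first two terms bound the main regime, where `r²/a ≤ 4`, and the last one the regime of few
  -- edges. The threshold on `n` ensures density at most `3/4` and `2T ≤ n`.
  refine ⟨1024 * K ^ 2 / η + 8192 * K ^ 2 / η ^ 2 + (T + 8 * T), ⌈4 * K + 2 * T⌉₊ + 2,
    by positivity, by omega, ?_⟩
  intro n hn A ψ r hA hψ hr hr2 hdens hquad hl2 hU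
  have hn2 : 2 ≤ n := by omega
  have hn' : (2 : ℝ) ≤ n := by exact_mod_cast hn2
  have hnK : 4 * K + 2 * T ≤ n := (Nat.le_ceil _).trans (by exact_mod_cast (by omega))
  have hn0 : (0 : ℝ) < n := by linarith
  have ha0 := hA.density_nonneg hn2
  obtain ⟨hd1, hd2⟩ := abs_le.1 hdens
  have hr1 : r ≤ 1 := by nlinarith
  have ha34 : density A ≤ 3 / 4 := by
    have : K * r / n ≤ 1 / 4 := by
      rw [div_le_iff₀ hn0]; nlinarith
    linarith
  set w := 8 * (K * r) / n / η with hw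
  have hw0 : 0 ≤ w := by positivity
  have hwη : |normQuad (centered A) ψ| ≤ w * η := by
    rw [hw, div_mul_cancel₀ _ hη.ne']; exact abs_normQuad_le hn2 _ _ hquad
  have hu : l2 (centerHalf ψ) ≤ 1 / 2 * √n := l2_le_of_abs_le (by norm_num) hψ
  have hsn : √(n : ℝ) ≤ n := by
    rw [Real.sqrt_le_left hn0.le]; nlinarith
  by_cases hcase : w ≤ density A / 8 ∧ r ^ 2 < 4 * density A
  · obtain ⟨hc1, hc2⟩ := hcase
    have ha : 0 < density A := by nlinarith
    refine (l2_psiUpdate_le hn2 hA.symm hη hU hwη ha ha34 hc1).trans ?_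
    have hra : r ^ 2 / density A ≤ 4 := by rw [div_le_iff₀ ha]; linarith
    have b1 : 32 * (w / density A) * l2 (centered A *ᵥ centerHalf ψ) ≤ 1024 * K ^ 2 / η := by
      calc _ ≤ 32 * (w / density A) * (K * r * n) := by gcongr
        _ = 256 * K ^ 2 / η * (r ^ 2 / density A) := by rw [hw]; field_simp; ring
        _ ≤ 256 * K ^ 2 / η * 4 := by gcongr
        _ = _ := by ring
    have b2 : 64 * (w ^ 2 / density A) * (n * l2 (centerHalf ψ)) ≤ 8192 * K ^ 2 / η ^ 2 := by
      calc _ ≤ 64 * (w ^ 2 / density A) * (n * (1 / 2 * n)) := by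
            gcongr; exact hu.trans (by gcongr)
        _ = 2048 * K ^ 2 / η ^ 2 * (r ^ 2 / density A) := by rw [hw]; field_simp; ring
        _ ≤ 2048 * K ^ 2 / η ^ 2 * 4 := by gcongr
        _ = _ := by ring
    linarith
  · have hRn : n * r ≤ R := by
      by_cases hr0 : r = 0
      · rw [hr0, mul_zero]; exact hR0.le
      have hrpos : 0 < r := lt_of_le_of_ne hr (Ne.symm hr0)
      -- If `w > a/8`, then `a < 64(K/η)(r/n)`, and closeness of `a` to `r²` adds one more `K r/n`:
      -- hence the `65` in `R`. If `r² ≥ 4a`, closeness alone suffices.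
      have hs : r ^ 2 ≤ R * (r / n) := by
        have hKe : K ≤ K / η := by rw [le_div_iff₀ hη]; nlinarith
        have hrn : 0 ≤ r / n := by positivity
        have e1 : K * r / n = K * (r / n) := by ring
        rw [e1] at hd1 hd2
        have hKr : K * (r / n) ≤ K / η * (r / n) := by gcongr
        have e3 : R * (r / n) = 65 * (K / η * (r / n)) := by rw [hR]; ring
        have h0 : 0 ≤ K / η * (r / n) := by positivity
        rw [not_and_or] at hcase
        rcases hcase with h | h
        · have e2 : w = 8 * (K / η * (r / n)) := by rw [hw]; field_simp
          linarith
        · linarith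
      have h3 : r * (n * r) ≤ r * R := by
        have := mul_le_mul_of_nonneg_left hs hn0.le
        rw [show (n : ℝ) * (R * (r / n)) = r * R by field_simp] at this
        nlinarith
      exact le_of_mul_le_mul_left h3 hrpos
    obtain ⟨P, Q, hP, hQ, hp, hq⟩ := pq_update_eq hn2 hA.symm hη hU hwη
    have hnn : 0 < (n : ℝ) ^ 2 := by positivity
    have hda : n ^ 2 * density A ≤ R ^ 2 + K * R := by
      have h1 : density A ≤ r ^ 2 + K * r / n := by linarith
      calc n ^ 2 * density A ≤ n ^ 2 * (r ^ 2 + K * r / n) := by gcongr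
        _ = (n * r) ^ 2 + K * (n * r) := by field_simp
        _ ≤ _ := by gcongr
    have hdw : n ^ 2 * (density A + w) ≤ T := by
      calc n ^ 2 * (density A + w) = n ^ 2 * density A + 8 * K * (n * r) / η := by
            rw [hw]; field_simp
        _ ≤ (R ^ 2 + K * R) + 8 * K * R / η := by gcongr
        _ = T := by rw [hT]
    have hT1 : 1 ≤ T := by
      have : 1 ≤ R := by rw [hR, le_div_iff₀ hη]; nlinarith
      have : 0 ≤ 8 * K * R / η := by positivity
      have : 0 ≤ K * R := by positivity
      nlinarith
    have hfin := l2_psiUpdate_le_of_few_edges hn2 hA hψ hw0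
      (by rw [hp]; exact (abs_add_le _ _).trans (by rw [abs_of_nonneg ha0]; linarith))
      (by rw [hq]; exact (abs_add_le _ _).trans (by rw [abs_of_nonneg ha0]; linarith))
      hT1 (by linarith) hdw
    have : 0 ≤ 1024 * K ^ 2 / η + 8192 * K ^ 2 / η ^ 2 := by positivity
    linarith

/-- One update maps bounded deviations from `1/2` to bounded deviations, uniformly over all
networks. -/
lemma step_bounded (C : ℝ) : ∃ C' : ℝ, 0 < C' ∧ ∀ (n : ℕ) (A : Matrix (Fin n) (Fin n) ℝ)
    (ψ : Fin n → ℝ), IsAdjacency A → (∀ i, |centerHalf ψ i| ≤ 1 / 2) → l2 (centerHalf ψ) ≤ C →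
    l2 (centerHalf (psiUpdate A ψ)) ≤ C' := by
  obtain ⟨C₁, n₀, hC₁, hn₀, H⟩ := step_bounded_of_density (K := 1 + C ^ 2) (η := 1 / 2)
    (by nlinarith [sq_nonneg C]) (by norm_num) (by norm_num)
  set n₁ := n₀ + ⌈16 * C ^ 2⌉₊ + 1 with hn₁
  refine ⟨C₁ + √n₁, by positivity, ?_⟩
  intro n A ψ hA hψ hC
  have hC0 : 0 ≤ C := (l2_nonneg _).trans hC
  by_cases hn : n₁ ≤ n
  · have hn2 : 2 ≤ n := by omega
    have hn' : (2 : ℝ) ≤ n := by exact_mod_cast hn2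
    have hnC : 16 * C ^ 2 ≤ (n : ℝ) - 1 := by
      have h1 : 16 * C ^ 2 ≤ (⌈16 * C ^ 2⌉₊ : ℝ) := Nat.le_ceil _
      have h2 : ((⌈16 * C ^ 2⌉₊ + 1 : ℕ) : ℝ) ≤ n := by exact_mod_cast (by omega)
      push_cast at h2
      linarith
    have hU : |normQuad (offDiag n) ψ| ≤ 1 / 2 := by
      refine (normQuad_offDiag_le hn2 ψ).trans ?_
      rw [mul_div_assoc', div_le_iff₀ (by linarith)]
      have : l2 (centerHalf ψ) ^ 2 ≤ C ^ 2 := by gcongr; exact l2_nonneg _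
      linarith
    -- Here `r = √(density B)` exactly, and Cauchy–Schwarz with the Frobenius norm gives bounds
    -- valid for every graph, so no independence of `ψ` and `B` is needed.
    have key : ∀ B : Matrix (Fin n) (Fin n) ℝ, IsAdjacency B → density B ≤ 1 / 2 →
        l2 (centerHalf (psiUpdate B ψ)) ≤ C₁ := by
      intro B hB hb
      have hb0 := hB.density_nonneg hn2
      have hM : l2 (centered B *ᵥ centerHalf ψ) ≤ n * √(density B) * C := by
        refine (l2_mulVec_le _ _).trans ?_
        exact mul_le_mul (Real.sqrt_le_iff.2 ⟨by positivity, hB.frobenius_centered hn2⟩) hC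
          (l2_nonneg _) (by positivity)
      have hr := Real.sqrt_nonneg (density B)
      have hnr : 0 ≤ n * √(density B) := by positivity
      refine H n (by omega) B ψ (√(density B)) hB hψ hr ?_ ?_ ?_ ?_ ?_
      · rwa [Real.sq_sqrt hb0]
      · rw [Real.sq_sqrt hb0, sub_self, abs_zero]; positivity
      · refine (abs_dotProduct_le _ _).trans ?_
        calc _ ≤ C * (n * √(density B) * C) := by gcongr; exact l2_nonneg _
          _ = C ^ 2 * (n * √(density B)) := by ring
          _ ≤ (1 + C ^ 2) * (n * √(density B)) := by gcongr; linarith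
          _ = _ := by ring
      · refine hM.trans ?_
        calc n * √(density B) * C ≤ n * √(density B) * (1 + C ^ 2) := by gcongr; nlinarith
          _ = _ := by ring
      · linarith
    have hfin : l2 (centerHalf (psiUpdate A ψ)) ≤ C₁ := by
      by_cases hd : density A ≤ 1 / 2
      · exact key A hA hd
      · rw [← psiUpdate_complement hn2 A (by linarith)]
        apply key _ hA.complement
        rw [IsAdjacency.density_complement hn2]
        linarith
    linarith [Real.sqrt_nonneg (n₁ : ℝ)]
  -- For small `n` the trivial bound by `√n/2` is absorbed in the constant.
  · have h1 : l2 (centerHalf (psiUpdate A ψ)) ≤ 1 / 2 * √n :=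
      l2_le_of_abs_le (by norm_num) (abs_centerHalf_psiUpdate_le A ψ)
    have h2 : √(n : ℝ) ≤ √(n₁ : ℝ) := Real.sqrt_le_sqrt (by exact_mod_cast (by omega))
    linarith [Real.sqrt_nonneg (n : ℝ)]

/-- One update maps bounded deviations from `1/2` to deviations of order `ρ` if the maximal degree
is at most of order `n ρ` and the density is at least of order `ρ`. -/
lemma step_contracts {C D c : ℝ} (hC : 0 < C) (hD : 0 < D) (hc : 0 < c) :
    ∃ (C' : ℝ) (n₀ : ℕ), 0 < C' ∧ ∀ n : ℕ, n₀ ≤ n → ∀ (A : Matrix (Fin n) (Fin n) ℝ)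
      (ψ : Fin n → ℝ) (ρ : ℝ), IsAdjacency A → 0 < ρ → c * ρ ≤ density A → density A ≤ 1 / 2 →
      (∀ i, ∑ j, A i j ≤ D * (n * ρ)) → l2 (centerHalf ψ) ≤ C →
      l2 (centerHalf (psiUpdate A ψ)) ≤ C' * ρ := by
  set w₀ : ℝ := 96 * D * C ^ 2 with hw₀
  have hw₀0 : 0 < w₀ := by positivity
  refine ⟨32 * (w₀ / c) * (6 * D * C) + 64 * (w₀ ^ 2 / c) * C,
    ⌈16 * C ^ 2 + 8 * w₀ / c⌉₊ + 2, by positivity, ?_⟩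
  intro n hn A ψ ρ hA hρ ha ha2 hdeg hC'
  have hn2 : 2 ≤ n := by omega
  have hn' : (2 : ℝ) ≤ n := by exact_mod_cast hn2
  have hn0 : (0 : ℝ) < n := by linarith
  have hnC : 16 * C ^ 2 + 8 * w₀ / c ≤ (n : ℝ) - 1 := by
    have h1 := Nat.le_ceil (16 * C ^ 2 + 8 * w₀ / c)
    have h2 : ((⌈16 * C ^ 2 + 8 * w₀ / c⌉₊ + 2 : ℕ) : ℝ) ≤ n := by exact_mod_cast hn
    push_cast at h2
    linarith
  have hwc0 : 0 < 8 * w₀ / c := by positivity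
  have hdpos : 0 < density A := lt_of_lt_of_le (by positivity) ha
  have hU : |normQuad (offDiag n) ψ| ≤ 1 - 1 / 2 := by
    refine (normQuad_offDiag_le hn2 ψ).trans ?_
    rw [mul_div_assoc', div_le_iff₀ (by linarith)]
    have : l2 (centerHalf ψ) ^ 2 ≤ C ^ 2 := by gcongr; exact l2_nonneg _
    linarith
  have hdD : density A ≤ D * ρ * 2 := by
    have h1 : ∑ i, ∑ j, A i j ≤ n * (D * (n * ρ)) := by
      refine (Finset.sum_le_sum fun i _ => hdeg i).trans ?_
      simp
    rw [total_eq hn2] at h1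
    have h3 : ((n : ℝ) - 1) * density A ≤ n * (D * ρ) := by
      have h4 : (n : ℝ) * ((n - 1) * density A) ≤ n * (n * (D * ρ)) := by linarith
      exact le_of_mul_le_mul_left h4 hn0
    have h5 : (n : ℝ) / 2 * density A ≤ (n - 1) * density A := by gcongr; linarith
    have h6 : (n : ℝ) / 2 * density A ≤ n / 2 * (D * ρ * 2) := by linarith
    exact le_of_mul_le_mul_left h6 (by linarith)
  have hM : l2 (centered A *ᵥ centerHalf ψ) ≤ 6 * D * C * (n * ρ) := by
    have e : centered A *ᵥ centerHalf ψ = A *ᵥ centerHalf ψ +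
        (-density A) • (offDiag n *ᵥ centerHalf ψ) := by
      rw [centered, Matrix.sub_mulVec, Matrix.smul_mulVec, neg_smul, sub_eq_add_neg]
    rw [e]
    refine (l2_add_le _ _).trans ?_
    rw [l2_smul, abs_neg, abs_of_pos hdpos]
    -- The Schur test replaces the Frobenius bound `n√a` by the maximal degree, which gains a factor
    -- of order `√ρ` both in `‖Ãu‖` and in `w`.
    have h1 := l2_mulVec_le_of_row_sum_le hA.symm hA.nonneg (by positivity) hdeg (centerHalf ψ)
    have h2 := l2_offDiag_mulVec_le (centerHalf ψ)
    have h3 : D * (n * ρ) * l2 (centerHalf ψ) ≤ D * (n * ρ) * C := by gcongr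
    have h4 : density A * l2 (offDiag n *ᵥ centerHalf ψ) ≤ D * ρ * 2 * (2 * (n * C)) := by
      refine mul_le_mul hdD (h2.trans (by gcongr)) (l2_nonneg _) (by positivity)
    have h5 : 0 ≤ D * (n * ρ) * C := by positivity
    linarith
  set w := w₀ * ρ / n with hw
  have hw0 : 0 ≤ w := by positivity
  have hwη : |normQuad (centered A) ψ| ≤ w * (1 / 2) := by
    have h1 : |centerHalf ψ ⬝ᵥ centered A *ᵥ centerHalf ψ| ≤ 6 * D * C ^ 2 * ρ * n := by
      refine (abs_dotProduct_le _ _).trans ?_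
      calc _ ≤ C * (6 * D * C * (n * ρ)) := mul_le_mul hC' hM (l2_nonneg _) hC.le
        _ = _ := by ring
    refine (abs_normQuad_le hn2 _ _ h1).trans (le_of_eq ?_)
    rw [hw, hw₀]; ring
  have hwa : w ≤ density A / 8 := by
    have h1 : 8 * w₀ / c ≤ n := by nlinarith [sq_nonneg C]
    rw [div_le_iff₀ hc] at h1
    have h2 : w ≤ c * ρ / 8 := by
      rw [hw, div_le_div_iff₀ hn0 (by norm_num)]
      calc w₀ * ρ * 8 = (8 * w₀) * ρ := by ring
        _ ≤ (n * c) * ρ := by gcongr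
        _ = _ := by ring
    linarith
  refine (l2_psiUpdate_le hn2 hA.symm (by norm_num) hU hwη hdpos (by linarith) hwa).trans ?_
  have b1 : 32 * (w / density A) * l2 (centered A *ᵥ centerHalf ψ) ≤
      32 * (w₀ / c) * (6 * D * C) * ρ := by
    calc _ ≤ 32 * (w / (c * ρ)) * (6 * D * C * (n * ρ)) := by
          gcongr
          exact l2_nonneg _
      _ = _ := by rw [hw]; field_simp
  have b2 : 64 * (w ^ 2 / density A) * (n * l2 (centerHalf ψ)) ≤ 64 * (w₀ ^ 2 / c) * C * ρ := by
    calc _ ≤ 64 * (w ^ 2 / (c * ρ)) * (n * C) := by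
          gcongr
          exact mul_nonneg hn0.le (l2_nonneg _)
      _ = 64 * (w₀ ^ 2 / c) * C * ρ / n := by rw [hw]; field_simp
      _ ≤ _ := div_le_self (by positivity) (by linarith)
  linarith

end

/-! ### Moments and degrees of the blockmodel -/

/-- Rewrites sums over ordered pairs as sums over the independent entries above the diagonal. -/
lemma sum_eq_sum_edges {n : ℕ} (f : Fin n → Fin n → ℝ) (hf : ∀ i, f i i = 0) :
    ∑ i, ∑ j, f i j =
      ∑ e : {e : Fin n × Fin n // e.1 < e.2}, (f e.1.1 e.1.2 + f e.1.2 e.1.1) := by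
  have h1 : ∀ i j, f i j = (if i < j then f i j else 0) + if j < i then f i j else 0 := by
    intro i j
    rcases lt_trichotomy i j with h | h | h
    · simp [h, h.not_gt]
    · subst h; simp [hf]
    · simp [h, h.not_gt]
  have h2 : ∑ i, ∑ j, f i j = ∑ i, ∑ j, if i < j then f i j + f j i else 0 := by
    calc ∑ i, ∑ j, f i j = ∑ i, ∑ j, ((if i < j then f i j else 0) + if j < i then f i j else 0) :=
          Finset.sum_congr rfl fun i _ => Finset.sum_congr rfl fun j _ => h1 i j
      _ = ∑ i, ∑ j, (if i < j then f i j else 0) + ∑ i, ∑ j, if j < i then f i j else 0 := by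
          simp only [Finset.sum_add_distrib]
      _ = ∑ i, ∑ j, (if i < j then f i j else 0) + ∑ i, ∑ j, if i < j then f j i else 0 := by
          congr 1; rw [Finset.sum_comm]
      _ = _ := by
          simp only [← Finset.sum_add_distrib]
          refine Finset.sum_congr rfl fun i _ => Finset.sum_congr rfl fun j _ => ?_
          split_ifs <;> simp
  rw [h2, ← Fintype.sum_prod_type' (f := fun i j => if i < j then f i j + f j i else 0),
    ← Finset.sum_filter]
  exact Finset.sum_subtype (p := fun e : Fin n × Fin n => e.1 < e.2)
    (Finset.univ.filter fun e : Fin n × Fin n => e.1 < e.2) (by simp)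
    (fun e => f e.1 e.2 + f e.2 e.1)

/-- The matrix of edge probabilities of the two-block model. -/
def meanMatrix {n : ℕ} (z : Fin n → Bool) (p q : ℝ) : Matrix (Fin n) (Fin n) ℝ :=
  Matrix.of fun i j => if i = j then 0 else if z i = z j then p else q

lemma meanMatrix_mem {n : ℕ} {z : Fin n → Bool} {p q v : ℝ} (hp : 0 ≤ p) (hq : 0 ≤ q) (hpv : p ≤ v) (hqv : q ≤ v) (i j : Fin n) :
    meanMatrix z p q i j ∈ Set.Icc 0 v := by
  simp only [meanMatrix, Matrix.of_apply]
  split_ifs <;> constructor <;> linarith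

lemma sum_coeff_sub {Ω : Type*} {n : ℕ} {z : Fin n → Bool} {p q : ℝ}
    {A : Ω → Matrix (Fin n) (Fin n) ℝ} (c : Fin n → Fin n → ℝ) (ω : Ω) :
    ∑ i, ∑ j, c i j * (A ω - meanMatrix z p q) i j =
      ∑ i, ∑ j, c i j * A ω i j - ∑ i, ∑ j, c i j * meanMatrix z p q i j := by
  simp only [Matrix.sub_apply, mul_sub, Finset.sum_sub_distrib]

namespace IsSBM

variable {Ω : Type*} [MeasurableSpace Ω] {P : Measure Ω} {n : ℕ}
  {z : Fin n → Bool} {p q v : ℝ} {A : Ω → Matrix (Fin n) (Fin n) ℝ}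

lemma isAdjacency (h : IsSBM P z p q A) (ω : Ω) : IsAdjacency (A ω) :=
  ⟨h.zero_or_one ω, h.symm ω, h.diag ω⟩

lemma entry_mem (h : IsSBM P z p q A) (ω : Ω) (i j : Fin n) : A ω i j ∈ Set.Icc (0 : ℝ) 1 := by
  rcases h.zero_or_one ω i j with h' | h' <;> simp [h']

lemma sum_coeff_eq (h : IsSBM P z p q A) (c : Fin n → Fin n → ℝ) (ω : Ω) :
    ∑ i, ∑ j, c i j * A ω i j =
      ∑ e : {e : Fin n × Fin n // e.1 < e.2}, (c e.1.1 e.1.2 + c e.1.2 e.1.1) * A ω e.1.1 e.1.2 := by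
  rw [sum_eq_sum_edges (fun i j => c i j * A ω i j) (fun i => by simp [h.diag])]
  refine Finset.sum_congr rfl fun e _ => ?_
  rw [(h.symm ω).apply e.1.1 e.1.2]
  ring

lemma measurableSet_edge (h : IsSBM P z p q A) (i j : Fin n) :
    MeasurableSet {ω | A ω i j = 1} :=
  h.measurable_entry i j (measurableSet_singleton 1)

lemma integral_entry (h : IsSBM P z p q A) (i j : Fin n) :
    ∫ ω, A ω i j ∂P = meanMatrix z p q i j := by
  by_cases hij : i = j
  · subst hij; simp [h.diag, meanMatrix]
  · have e : (fun ω => A ω i j) = Set.indicator {ω | A ω i j = 1} 1 := by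
      ext ω
      rcases h.zero_or_one ω i j with h' | h' <;> simp [h', Set.indicator]
    rw [e, integral_indicator_one (h.measurableSet_edge i j), h.prob i j hij]
    simp [meanMatrix, hij]

variable [IsProbabilityMeasure P]

lemma memLp_entry (h : IsSBM P z p q A) (i j : Fin n) : MemLp (fun ω => A ω i j) 2 P :=
  memLp_of_bounded (ae_of_all _ fun ω => h.entry_mem ω i j)
    (h.measurable_entry i j).aestronglyMeasurable _

lemma variance_entry_le (h : IsSBM P z p q A) (hp : 0 ≤ p) (hq : 0 ≤ q) (hpv : p ≤ v)
    (hqv : q ≤ v) (i j : Fin n) : Var[fun ω => A ω i j; P] ≤ v := by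
  refine (variance_le_expectation_sq (h.measurable_entry i j).aestronglyMeasurable).trans ?_
  have e : (fun ω => A ω i j) ^ 2 = fun ω => A ω i j := by
    ext ω; exact (h.isAdjacency ω).sq_eq i j
  rw [e, h.integral_entry]
  exact (meanMatrix_mem hp hq hpv hqv i j).2

/-- An edge carries the weight `c i j + c j i`, and `(x + y)² ≤ 2(x² + y²)` gives the factor `2`. -/
lemma variance_sum_le (h : IsSBM P z p q A) (hp : 0 ≤ p) (hq : 0 ≤ q) (hpv : p ≤ v)
    (hqv : q ≤ v) (c : Fin n → Fin n → ℝ) :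
    Var[fun ω => ∑ i, ∑ j, c i j * A ω i j; P] ≤ 2 * v * ∑ i, ∑ j, c i j ^ 2 := by
  have hv : 0 ≤ v := hp.trans hpv
  have e : (fun ω => ∑ i, ∑ j, c i j * A ω i j) =
      ∑ e : {e : Fin n × Fin n // e.1 < e.2},
        fun ω => (c e.1.1 e.1.2 + c e.1.2 e.1.1) * A ω e.1.1 e.1.2 := by
    ext ω; rw [h.sum_coeff_eq c ω, Finset.sum_apply]
  rw [e, IndepFun.variance_sum]
  · calc _ ≤ ∑ e : {e : Fin n × Fin n // e.1 < e.2},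
          (2 * v * c e.1.1 e.1.2 ^ 2 * offDiag n e.1.1 e.1.2 +
            2 * v * c e.1.2 e.1.1 ^ 2 * offDiag n e.1.2 e.1.1) := by
          refine Finset.sum_le_sum fun e _ => ?_
          rw [variance_const_mul, offDiag_apply, offDiag_apply, if_neg e.2.ne, if_neg e.2.ne']
          have h1 := h.variance_entry_le hp hq hpv hqv e.1.1 e.1.2
          calc _ ≤ (c e.1.1 e.1.2 + c e.1.2 e.1.1) ^ 2 * v := by gcongr
            _ ≤ _ := by nlinarith [mul_nonneg hv (sq_nonneg (c e.1.1 e.1.2 - c e.1.2 e.1.1))]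
      _ = ∑ i, ∑ j, 2 * v * c i j ^ 2 * offDiag n i j := by
          rw [sum_eq_sum_edges (fun i j => 2 * v * c i j ^ 2 * offDiag n i j)
            (fun i => by simp [offDiag_apply])]
      _ ≤ ∑ i, ∑ j, 2 * v * c i j ^ 2 := by
          refine Finset.sum_le_sum fun i _ => Finset.sum_le_sum fun j _ => ?_
          have : 0 ≤ 2 * v * c i j ^ 2 := by positivity
          rw [offDiag_apply]; split_ifs <;> linarith
      _ = _ := by simp only [Finset.mul_sum]
  · intro e _
    exact (h.memLp_entry _ _).const_mul _
  · intro e _ e' _ hne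
    exact (h.indep.indepFun hne).comp (measurable_const_mul (c e.1.1 e.1.2 + c e.1.2 e.1.1))
      (measurable_const_mul (c e'.1.1 e'.1.2 + c e'.1.2 e'.1.1))

lemma memLp_sum (h : IsSBM P z p q A) (c : Fin n → Fin n → ℝ) :
    MemLp (fun ω => ∑ i, ∑ j, c i j * A ω i j) 2 P :=
  memLp_finsetSum _ fun i _ => memLp_finsetSum _ fun j _ => (h.memLp_entry i j).const_mul _

lemma integral_sum (h : IsSBM P z p q A) (c : Fin n → Fin n → ℝ) :
    ∫ ω, ∑ i, ∑ j, c i j * A ω i j ∂P = ∑ i, ∑ j, c i j * meanMatrix z p q i j := by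
  have hi : ∀ i j, Integrable (fun ω => c i j * A ω i j) P := fun i j =>
    ((h.memLp_entry i j).integrable (by norm_num)).const_mul _
  rw [integral_finsetSum _ fun i _ => integrable_finsetSum _ fun j _ => hi i j]
  refine Finset.sum_congr rfl fun i _ => ?_
  rw [integral_finsetSum _ fun j _ => hi i j]
  refine Finset.sum_congr rfl fun j _ => ?_
  rw [integral_const_mul, h.integral_entry]

lemma integrable_sq_sum (h : IsSBM P z p q A) (c : Fin n → Fin n → ℝ) :
    Integrable (fun ω => (∑ i, ∑ j, c i j * (A ω - meanMatrix z p q) i j) ^ 2) P := by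
  simp only [sum_coeff_sub c]
  exact ((h.memLp_sum c).sub (memLp_const _)).integrable_sq

lemma integral_sq_sum_le (h : IsSBM P z p q A) (hp : 0 ≤ p) (hq : 0 ≤ q) (hpv : p ≤ v)
    (hqv : q ≤ v) (c : Fin n → Fin n → ℝ) :
    ∫ ω, (∑ i, ∑ j, c i j * (A ω - meanMatrix z p q) i j) ^ 2 ∂P ≤
      2 * v * ∑ i, ∑ j, c i j ^ 2 := by
  have h1 := h.variance_sum_le hp hq hpv hqv c
  rw [variance_eq_integral (h.memLp_sum c).aemeasurable, h.integral_sum] at h1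
  simpa only [sum_coeff_sub c] using h1

/-- The complement of a blockmodel is a blockmodel. -/
lemma complement (h : IsSBM P z p q A) :
    IsSBM P z (1 - p) (1 - q) (fun ω => offDiag n - A ω) where
  measurable_entry i j := (h.measurable_entry i j).const_sub _
  zero_or_one ω := (h.isAdjacency ω).complement.zero_or_one
  symm ω := (h.isAdjacency ω).complement.symm
  diag ω := (h.isAdjacency ω).complement.diag
  prob i j hij := by
    have e : {ω | (offDiag n - A ω) i j = 1} = {ω | A ω i j = 1}ᶜ := by
      ext ω
      rcases h.zero_or_one ω i j with h' | h' <;> simp [h', offDiag_apply, hij]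
    rw [e, probReal_compl_eq_one_sub (h.measurableSet_edge i j),
      h.prob i j hij]
    split_ifs <;> rfl
  indep := h.indep.comp (fun e x => offDiag n e.1.1 e.1.2 - x)
    (fun e => measurable_const.sub measurable_id)

/-- Chernoff's bound for the degree of a vertex. -/
lemma degree_tail (h : IsSBM P z p q A) (hp : 0 ≤ p) (hq : 0 ≤ q) (hpv : p ≤ v) (hqv : q ≤ v)
    (i : Fin n) (x : ℝ) :
    P.real {ω | x ≤ ∑ j, A ω i j} ≤ Real.exp (2 * v * n - x) := by
  have hv : 0 ≤ v := hp.trans hpv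
  -- `d e` indicates that the edge `e` touches `i`, so the degree is a sum of independent variables.
  set d : {e : Fin n × Fin n // e.1 < e.2} → ℝ := fun e =>
    (if e.1.1 = i then 1 else 0) + if e.1.2 = i then 1 else 0 with hd
  set Y : {e : Fin n × Fin n // e.1 < e.2} → Ω → ℝ := fun e ω => d e * A ω e.1.1 e.1.2 with hY
  have e1 : (fun ω => ∑ j, A ω i j) = ∑ e, Y e := by
    ext ω
    have := h.sum_coeff_eq (fun k _ => if k = i then 1 else 0) ω
    simpa [hY, hd] using this
  have hYm : ∀ e, Measurable (Y e) := fun e => (h.measurable_entry _ _).const_mul _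
  have hind : iIndepFun Y P := h.indep.comp (fun e x => d e * x) fun e => measurable_const_mul _
  have hd01 : ∀ e, d e = 0 ∨ d e = 1 := by
    intro e
    have hne := e.2.ne
    simp only [hd]
    split_ifs with h1 h2
    · exact absurd (h1.trans h2.symm) hne
    all_goals simp
  have hmgf : ∀ e, mgf (Y e) P 1 ≤ Real.exp (2 * v * d e) := by
    intro e
    -- The exponential moment is taken at `1`: `e^y ≤ 1 + 2y` for `y ∈ {0, 1}`, because `e < 3`.
    have e2 : ∀ ω, Real.exp (1 * Y e ω) ≤ 1 + 2 * d e * A ω e.1.1 e.1.2 := by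
      intro ω
      rcases hd01 e with h1 | h1 <;> rcases h.zero_or_one ω e.1.1 e.1.2 with h2 | h2 <;>
        simp [hY, h1, h2]
      linarith [Real.exp_one_lt_d9]
    have hint : Integrable (fun ω => 1 + 2 * d e * A ω e.1.1 e.1.2) P :=
      (integrable_const _).add (((h.memLp_entry _ _).integrable (by norm_num)).const_mul _)
    calc mgf (Y e) P 1 ≤ ∫ ω, (1 + 2 * d e * A ω e.1.1 e.1.2) ∂P :=
          integral_mono_of_nonneg (ae_of_all _ fun ω => (Real.exp_pos _).le) hint (ae_of_all _ e2)
      _ = 1 + 2 * d e * meanMatrix z p q e.1.1 e.1.2 := by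
          rw [integral_add (integrable_const _)
            (((h.memLp_entry _ _).integrable (by norm_num)).const_mul _), integral_const_mul,
            h.integral_entry]
          simp
      _ ≤ 2 * v * d e + 1 := by
          have h1 := (meanMatrix_mem (z := z) hp hq hpv hqv e.1.1 e.1.2).2
          rcases hd01 e with h2 | h2 <;> rw [h2] <;> linarith
      _ ≤ _ := Real.add_one_le_exp _
  have hsumd : ∑ e, d e ≤ n := by
    have h1 := sum_eq_sum_edges (fun k l => (if k = i then 1 else 0) * offDiag n k l)
      (fun k => by simp [offDiag_apply])
    have h2 : ∑ e, d e = ∑ l, offDiag n i l := by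
      have h3 : ∑ k, ∑ l, (if k = i then (1 : ℝ) else 0) * offDiag n k l = ∑ l, offDiag n i l := by
        simp
      rw [← h3, h1]
      refine Finset.sum_congr rfl fun e _ => ?_
      rw [offDiag_apply, offDiag_apply, if_neg e.2.ne, if_neg e.2.ne', mul_one, mul_one]
    rw [h2]
    calc ∑ l, offDiag n i l ≤ ∑ _l : Fin n, (1 : ℝ) :=
          Finset.sum_le_sum fun l _ => by rw [offDiag_apply]; split_ifs <;> simp
      _ = n := by simp
  have hbound : mgf (fun ω => ∑ j, A ω i j) P 1 ≤ Real.exp (2 * v * n) := by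
    rw [e1, hind.mgf_sum hYm]
    calc ∏ e, mgf (Y e) P 1 ≤ ∏ e, Real.exp (2 * v * d e) :=
          Finset.prod_le_prod (fun e _ => mgf_nonneg) fun e _ => hmgf e
      _ = Real.exp (2 * v * ∑ e, d e) := by rw [← Real.exp_sum, Finset.mul_sum]
      _ ≤ _ := by gcongr
  have hint : Integrable (fun ω => Real.exp (1 * ∑ j, A ω i j)) P := by
    have hm : Measurable fun ω => Real.exp (1 * ∑ j, A ω i j) :=
      Real.measurable_exp.comp ((Finset.measurable_sum _ fun j _ =>
        h.measurable_entry i j).const_mul _)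
    refine Integrable.of_bound hm.aestronglyMeasurable (Real.exp n) (ae_of_all _ fun ω => ?_)
    rw [Real.norm_eq_abs, Real.abs_exp, one_mul]
    gcongr
    calc ∑ j, A ω i j ≤ ∑ _j : Fin n, (1 : ℝ) :=
          Finset.sum_le_sum fun j _ => (h.entry_mem ω i j).2
      _ = n := by simp
  refine (measure_ge_le_exp_mul_mgf x zero_le_one hint).trans ?_
  calc _ ≤ Real.exp (-1 * x) * Real.exp (2 * v * n) := by gcongr
    _ = _ := by rw [← Real.exp_add]; ring_nf

end IsSBM

/-! ### Signal and noise in the centered network -/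

/-- The size of a noise matrix `X` as seen by the vector `u`: squared total sum, squared quadratic
form, and squared norm of `X u`. -/
def fluctuation {n : ℕ} (X : Matrix (Fin n) (Fin n) ℝ) (u : Fin n → ℝ) : ℝ :=
  (∑ i, ∑ j, X i j) ^ 2 + (u ⬝ᵥ X *ᵥ u) ^ 2 + l2 (X *ᵥ u) ^ 2

/-- The signs `±1` of the communities. -/
def commSign {n : ℕ} (z : Fin n → Bool) (i : Fin n) : ℝ := if z i then 1 else -1

lemma abs_commSign {n : ℕ} (z : Fin n → Bool) (i : Fin n) : |commSign z i| = 1 := by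
  unfold commSign; split_ifs <;> simp

lemma sum_commSign {m : ℕ} {z : Fin (2 * m) → Bool}
    (hz : (Finset.univ.filter fun i => z i = true).card = m) : ∑ i, commSign z i = 0 := by
  have h1 : ∀ i, commSign z i = 2 * (if z i = true then 1 else 0) - 1 := by
    intro i; unfold commSign; split_ifs <;> norm_num
  simp only [h1, Finset.sum_sub_distrib, ← Finset.mul_sum, Finset.sum_boole, hz]
  simp

/-- Off the diagonal the mean has rank two, spanned by the constant vector and the community signs.
The first direction is almost removed by centering, and the second sees `u` only through its sign
sum. -/
lemma meanMatrix_eq {n : ℕ} (z : Fin n → Bool) (p q : ℝ) (i j : Fin n) :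
    meanMatrix z p q i j = offDiag n i j * ((p + q) / 2 + (p - q) / 2 * commSign z i * commSign z j) := by
  simp only [meanMatrix, Matrix.of_apply, offDiag_apply, commSign]
  by_cases h : i = j
  · simp [h]
  · cases hi : z i <;> cases hj : z j <;> simp [h] <;> ring

section deterministic
variable {n : ℕ} {z : Fin n → Bool} {p q : ℝ}

lemma commSign_mul_self (z : Fin n → Bool) (i : Fin n) : commSign z i * commSign z i = 1 := by
  unfold commSign; split_ifs <;> simp

lemma meanMatrix_mulVec (z : Fin n → Bool) (p q : ℝ) (u : Fin n → ℝ) (i : Fin n) :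
    (meanMatrix z p q *ᵥ u) i = (p + q) / 2 * (∑ j, u j - u i) +
      (p - q) / 2 * (commSign z i * ∑ j, commSign z j * u j - u i) := by
  have h1 : (meanMatrix z p q *ᵥ u) i = (p + q) / 2 * (offDiag n *ᵥ u) i +
      (p - q) / 2 * commSign z i * (offDiag n *ᵥ fun j => commSign z j * u j) i := by
    simp only [Matrix.mulVec, dotProduct, Finset.mul_sum, ← Finset.sum_add_distrib]
    exact Finset.sum_congr rfl fun j _ => by rw [meanMatrix_eq]; ring
  rw [h1, offDiag_mulVec, offDiag_mulVec]
  linear_combination -(p - q) / 2 * u i * commSign_mul_self z i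

/-- The correction to `(p + q)/2` arises because the missing diagonal consists of within-community
pairs only. -/
lemma density_meanMatrix (hn : 2 ≤ n) (hz : ∑ i, commSign z i = 0) :
    density (meanMatrix z p q) = (p + q) / 2 - (p - q) / (2 * (n - 1)) := by
  have hn' : (2 : ℝ) ≤ n := by exact_mod_cast hn
  have h1 : (n : ℝ) - 1 ≠ 0 := by linarith
  have h2 : (n : ℝ) ≠ 0 := by linarith
  have h : ∀ i, ∑ j, meanMatrix z p q i j = (p + q) / 2 * (n - 1) + (p - q) / 2 * (0 - 1) := by
    intro i
    have := meanMatrix_mulVec z p q (fun _ => 1) i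
    simpa [Matrix.mulVec, dotProduct, hz] using this
  simp only [density, h]
  simp
  field_simp
  ring

lemma le_density_meanMatrix (hn : 3 ≤ n) (hz : ∑ i, commSign z i = 0) (hp : 0 ≤ p) (hq : 0 ≤ q) :
    p ≤ 4 * density (meanMatrix z p q) ∧ q ≤ 4 * density (meanMatrix z p q) := by
  have hn' : (3 : ℝ) ≤ n := by exact_mod_cast hn
  have h1 : (0 : ℝ) < 2 * (n - 1) := by linarith
  rw [density_meanMatrix (by omega) hz]
  have h2 : p / (2 * (n - 1)) ≤ p / 4 := by
    apply div_le_div_of_nonneg_left hp <;> linarith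
  have h3 : 0 ≤ q / (2 * ((n : ℝ) - 1)) := by positivity
  rw [sub_div]
  constructor <;> linarith

lemma density_meanMatrix_le (hn : 2 ≤ n) {v : ℝ} (hpv : p ≤ v) (hqv : q ≤ v) : density (meanMatrix z p q) ≤ v := by
  have hn' : (2 : ℝ) ≤ n := by exact_mod_cast hn
  have hD : 0 < (n : ℝ) * (n - 1) := by apply mul_pos <;> linarith
  rw [density, div_le_iff₀ hD]
  have h := sum_offDiag (n := n)
  rw [← h, Finset.mul_sum]
  refine Finset.sum_le_sum fun i _ => ?_
  rw [Finset.mul_sum]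
  refine Finset.sum_le_sum fun j _ => ?_
  simp only [meanMatrix, Matrix.of_apply, offDiag_apply]
  split_ifs <;> linarith

lemma sum_meanMatrix_quad (z : Fin n → Bool) (p q : ℝ) (u : Fin n → ℝ) :
    u ⬝ᵥ meanMatrix z p q *ᵥ u = (p + q) / 2 * ((∑ j, u j) ^ 2 - ∑ j, u j ^ 2) +
      (p - q) / 2 * ((∑ j, commSign z j * u j) ^ 2 - ∑ j, u j ^ 2) := by
  have h : ∀ i, u i * (meanMatrix z p q *ᵥ u) i = (p + q) / 2 * (u i * ∑ j, u j - u i ^ 2) +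
      (p - q) / 2 * (commSign z i * u i * ∑ j, commSign z j * u j - u i ^ 2) := by
    intro i; rw [meanMatrix_mulVec]; ring
  simp only [dotProduct, h, Finset.sum_add_distrib, ← Finset.mul_sum, Finset.sum_sub_distrib,
    ← Finset.sum_mul]
  ring

/-- The deviation of the centered network from its noise part. -/
lemma centered_eq (A : Matrix (Fin n) (Fin n) ℝ) :
    centered A = (A - meanMatrix z p q) + (meanMatrix z p q - density (meanMatrix z p q) • offDiag n)
      + (density (meanMatrix z p q) - density A) • offDiag n := by
  rw [centered, sub_smul]; abel

variable {u : Fin n → ℝ} {k a : ℝ}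

lemma abs_sum_le_half (hu : ∀ i, |u i| ≤ 1 / 2) : |∑ i, u i| ≤ n / 2 := by
  refine (Finset.abs_sum_le_sum_abs _ _).trans ((Finset.sum_le_sum fun j _ => hu j).trans ?_)
  simp; linarith

lemma sum_sq_le_quarter (hu : ∀ i, |u i| ≤ 1 / 2) : ∑ i, u i ^ 2 ≤ n / 4 := by
  calc ∑ i, u i ^ 2 ≤ ∑ _i : Fin n, (1 / 4 : ℝ) :=
        Finset.sum_le_sum fun i _ => by nlinarith [abs_le.1 (hu i)]
    _ = n / 4 := by simp; ring

lemma abs_offDiag_quad_le (hn : 2 ≤ n) (hu : ∀ i, |u i| ≤ 1 / 2) :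
    |u ⬝ᵥ offDiag n *ᵥ u| ≤ n ^ 2 / 2 := by
  have hn' : (2 : ℝ) ≤ n := by exact_mod_cast hn
  rw [offDiag_quad]
  have h1 := abs_le.1 (abs_sum_le_half hu)
  have h2 := sum_sq_le_quarter hu
  have h3 : 0 ≤ ∑ i, u i ^ 2 := Finset.sum_nonneg fun i _ => sq_nonneg _
  rw [abs_le]; constructor <;> nlinarith

/-- After centering, each coordinate is `p - q` times a bounded term plus half the sign sum, hence
of order `√n`. -/
lemma l2_signal_le (hn : 2 ≤ n) (hz : ∑ i, commSign z i = 0) (hu : ∀ i, |u i| ≤ 1 / 2)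
    (hk : 1 ≤ k) (hS : |∑ j, commSign z j * u j| ≤ k * √n) (ha : |p - q| ≤ a) :
    l2 ((meanMatrix z p q - density (meanMatrix z p q) • offDiag n) *ᵥ u) ≤ a * (3 * k) * n := by
  have hn' : (2 : ℝ) ≤ n := by exact_mod_cast hn
  have hs1 : 1 ≤ √(n : ℝ) := by rw [Real.one_le_sqrt]; linarith
  have ha0 : 0 ≤ a := (abs_nonneg _).trans ha
  have h : ∀ i, |((meanMatrix z p q - density (meanMatrix z p q) • offDiag n) *ᵥ u) i| ≤
      a * (3 * k) * √n := by
    intro i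
    have e : ((meanMatrix z p q - density (meanMatrix z p q) • offDiag n) *ᵥ u) i =
        (p - q) * ((∑ j, u j - u i) / (2 * (n - 1)) +
          (commSign z i * ∑ j, commSign z j * u j - u i) / 2) := by
      rw [Matrix.sub_mulVec, Matrix.smul_mulVec, Pi.sub_apply, Pi.smul_apply, offDiag_mulVec,
        meanMatrix_mulVec, density_meanMatrix hn hz, smul_eq_mul]
      ring
    rw [e, abs_mul]
    have h1 := abs_le.1 (abs_sum_le_half hu)
    have h2 := abs_le.1 (hu i)
    have h3 : |(∑ j, u j - u i) / (2 * ((n : ℝ) - 1))| ≤ 1 := by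
      rw [abs_div, abs_of_pos (by linarith : (0 : ℝ) < 2 * (n - 1)), div_le_one (by linarith), abs_le]
      constructor <;> linarith
    have h4 : |commSign z i * ∑ j, commSign z j * u j| ≤ k * √n := by
      rw [abs_mul, abs_commSign, one_mul]; exact hS
    have h5 : 1 ≤ k * √n := by nlinarith
    have h6 : |(∑ j, u j - u i) / (2 * ((n : ℝ) - 1)) +
        (commSign z i * ∑ j, commSign z j * u j - u i) / 2| ≤ 3 * k * √n := by
      have h7 := abs_le.1 h3
      have h8 := abs_le.1 h4
      rw [abs_le]; constructor <;> linarith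
    calc _ ≤ a * (3 * k * √n) := by gcongr
      _ = _ := by ring
  refine (l2_le_of_abs_le (by positivity) h).trans (le_of_eq ?_)
  rw [mul_assoc, Real.mul_self_sqrt (by linarith)]

lemma abs_signal_quad_le (hn : 2 ≤ n) (hz : ∑ i, commSign z i = 0) (hu : ∀ i, |u i| ≤ 1 / 2)
    (hk : 1 ≤ k) (hS : |∑ j, commSign z j * u j| ≤ k * √n) (ha : |p - q| ≤ a) :
    |u ⬝ᵥ (meanMatrix z p q - density (meanMatrix z p q) • offDiag n) *ᵥ u| ≤ a * (2 * k ^ 2) * n := by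
  have hn' : (2 : ℝ) ≤ n := by exact_mod_cast hn
  have ha0 : 0 ≤ a := (abs_nonneg _).trans ha
  have e : u ⬝ᵥ (meanMatrix z p q - density (meanMatrix z p q) • offDiag n) *ᵥ u =
      (p - q) * ((u ⬝ᵥ offDiag n *ᵥ u) / (2 * (n - 1)) +
        ((∑ j, commSign z j * u j) ^ 2 - ∑ j, u j ^ 2) / 2) := by
    rw [Matrix.sub_mulVec, dotProduct_sub, Matrix.smul_mulVec, dotProduct_smul,
      sum_meanMatrix_quad, density_meanMatrix hn hz, smul_eq_mul, offDiag_quad]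
    ring
  rw [e, abs_mul]
  have h1 : |(u ⬝ᵥ offDiag n *ᵥ u) / (2 * ((n : ℝ) - 1))| ≤ n / 2 := by
    rw [abs_div, abs_of_pos (by linarith : (0 : ℝ) < 2 * (n - 1)), div_le_iff₀ (by linarith)]
    refine (abs_offDiag_quad_le hn hu).trans ?_
    nlinarith
  have h2 := sum_sq_le_quarter hu
  have h3 : 0 ≤ ∑ i, u i ^ 2 := Finset.sum_nonneg fun i _ => sq_nonneg _
  have h4 : (∑ j, commSign z j * u j) ^ 2 ≤ k ^ 2 * n := by
    have h5 : |∑ j, commSign z j * u j| ^ 2 ≤ (k * √n) ^ 2 := by gcongr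
    rwa [sq_abs, mul_pow, Real.sq_sqrt (by linarith)] at h5
  have h5 : (n : ℝ) ≤ k ^ 2 * n := le_mul_of_one_le_left (by linarith) (one_le_pow₀ hk)
  have h6 : |(u ⬝ᵥ offDiag n *ᵥ u) / (2 * ((n : ℝ) - 1)) +
      ((∑ j, commSign z j * u j) ^ 2 - ∑ j, u j ^ 2) / 2| ≤ 2 * k ^ 2 * n := by
    have h7 := abs_le.1 h1
    have h8 := sq_nonneg (∑ j, commSign z j * u j)
    rw [abs_le]; constructor <;> linarith
  calc _ ≤ a * (2 * k ^ 2 * n) := by gcongr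
    _ = _ := by ring

lemma abs_density_sub_le (hn : 2 ≤ n) {A E : Matrix (Fin n) (Fin n) ℝ} {x : ℝ}
    (h : |∑ i, ∑ j, (A - E) i j| ≤ x * n) : |density A - density E| ≤ 2 * x / n := by
  have hn' : (2 : ℝ) ≤ n := by exact_mod_cast hn
  have hD : 0 < (n : ℝ) * (n - 1) := by apply mul_pos <;> linarith
  have hx : 0 ≤ x := by
    by_contra hx
    have := (abs_nonneg _).trans h
    nlinarith
  simp only [Matrix.sub_apply, Finset.sum_sub_distrib] at h
  rw [density, density, ← sub_div, abs_div, abs_of_pos hD, div_le_div_iff₀ hD (by linarith)]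
  nlinarith [mul_nonneg hx (by positivity : (0 : ℝ) ≤ (n : ℝ) * n)]

/-- The hypotheses of `step_bounded_of_density` hold when the noise is of its typical size. -/
lemma centered_bounds (hn : 3 ≤ n) (hz : ∑ i, commSign z i = 0) (hp : 0 ≤ p) (hq : 0 ≤ q)
    (hp1 : p ≤ 1) (hq1 : q ≤ 1) (hu : ∀ i, |u i| ≤ 1 / 2) (hk : 1 ≤ k)
    (hS : |∑ j, commSign z j * u j| ≤ k * √n) {A : Matrix (Fin n) (Fin n) ℝ} {r : ℝ}
    (hr : r = √(density (meanMatrix z p q)))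
    (hF : fluctuation (A - meanMatrix z p q) u ≤ (k * r * n) ^ 2) :
    |density A - r ^ 2| ≤ 17 * k ^ 2 * r / n ∧
      |u ⬝ᵥ centered A *ᵥ u| ≤ 17 * k ^ 2 * r * n ∧ l2 (centered A *ᵥ u) ≤ 17 * k ^ 2 * r * n := by
  have hn2 : 2 ≤ n := by omega
  have hn' : (3 : ℝ) ≤ n := by exact_mod_cast hn
  have hn0 : (0 : ℝ) < n := by linarith
  obtain ⟨hpa, hqa⟩ := le_density_meanMatrix (z := z) hn hz hp hq
  have ha1 := density_meanMatrix_le (z := z) hn2 hp1 hq1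
  set a := density (meanMatrix z p q) with ha
  have ha0 : 0 ≤ a := by linarith
  have hr0 : 0 ≤ r := by rw [hr]; exact Real.sqrt_nonneg _
  have hra : r ^ 2 = a := by rw [hr, Real.sq_sqrt ha0]
  have hr1 : r ≤ 1 := by nlinarith
  -- The signal has order `a`, the noise order `r = √a`; as `r ≤ 1`, the noise scale covers both.
  have har : 4 * a ≤ 4 * r := by nlinarith
  have hpq : |p - q| ≤ 4 * r := by rw [abs_le]; constructor <;> linarith
  have hkrn : 0 ≤ k * r * n := by positivity
  have hF1 : |∑ i, ∑ j, (A - meanMatrix z p q) i j| ≤ k * r * n := by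
    apply abs_le_of_sq_le_sq _ hkrn
    unfold fluctuation at hF; linarith [sq_nonneg (u ⬝ᵥ (A - meanMatrix z p q) *ᵥ u),
      sq_nonneg (l2 ((A - meanMatrix z p q) *ᵥ u))]
  have hF2 : |u ⬝ᵥ (A - meanMatrix z p q) *ᵥ u| ≤ k * r * n := by
    apply abs_le_of_sq_le_sq _ hkrn
    unfold fluctuation at hF; linarith [sq_nonneg (∑ i, ∑ j, (A - meanMatrix z p q) i j),
      sq_nonneg (l2 ((A - meanMatrix z p q) *ᵥ u))]
  have hF3 : l2 ((A - meanMatrix z p q) *ᵥ u) ≤ k * r * n := by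
    apply le_of_sq_le_sq _ hkrn
    unfold fluctuation at hF; linarith [sq_nonneg (∑ i, ∑ j, (A - meanMatrix z p q) i j),
      sq_nonneg (u ⬝ᵥ (A - meanMatrix z p q) *ᵥ u)]
  have hd := abs_density_sub_le hn2 hF1
  rw [← ha] at hd
  have hd' : |a - density A| ≤ 2 * (k * r) / n := by rwa [abs_sub_comm]
  have hkk : k ≤ k ^ 2 := by nlinarith
  have hkr : k * r ≤ k ^ 2 * r := by gcongr
  have hkrn2 : k * r * n ≤ k ^ 2 * r * n := mul_le_mul_of_nonneg_right hkr hn0.le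
  refine ⟨?_, ?_, ?_⟩
  · rw [hra]
    have h0 : 0 ≤ k ^ 2 * r := by positivity
    exact hd.trans (div_le_div_of_nonneg_right (by linarith) hn0.le)
  · rw [centered_eq (z := z) (p := p) (q := q) A, Matrix.add_mulVec, Matrix.add_mulVec,
      dotProduct_add, dotProduct_add, ← ha]
    have h2 := abs_signal_quad_le hn2 hz hu hk hS hpq
    rw [← ha] at h2
    have h3 : |u ⬝ᵥ ((a - density A) • offDiag n) *ᵥ u| ≤ k * r * n := by
      rw [Matrix.smul_mulVec, dotProduct_smul, smul_eq_mul, abs_mul]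
      calc _ ≤ 2 * (k * r) / n * (n ^ 2 / 2) := by
            gcongr; exact abs_offDiag_quad_le hn2 hu
        _ = _ := by field_simp
    refine (abs_add_three _ _ _).trans ?_
    have h0 : 0 ≤ k ^ 2 * r * n := hkrn.trans hkrn2
    linarith
  · rw [centered_eq (z := z) (p := p) (q := q) A, Matrix.add_mulVec, Matrix.add_mulVec, ← ha]
    have h2 := l2_signal_le hn2 hz hu hk hS hpq
    rw [← ha] at h2
    have h3 : l2 (((a - density A) • offDiag n) *ᵥ u) ≤ 2 * (k * r * n) := by
      rw [Matrix.smul_mulVec, l2_smul]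
      have h4 : l2 u ≤ 1 / 2 * n := by
        refine (l2_le_of_abs_le (by norm_num) hu).trans ?_
        gcongr
        rw [Real.sqrt_le_left hn0.le]; nlinarith
      have h5 := l2_offDiag_mulVec_le u
      calc _ ≤ 2 * (k * r) / n * (2 * (n * (1 / 2 * n))) := by
            gcongr
            · exact l2_nonneg _
            · exact h5.trans (by gcongr)
        _ = _ := by field_simp
    refine (l2_add_le _ _).trans ((add_le_add_left (l2_add_le _ _) _).trans ?_)
    have h4 : r * k ≤ r * k ^ 2 := by gcongr
    have h5 : r * k * n ≤ r * k ^ 2 * n := by gcongr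
    have h0 : 0 ≤ k ^ 2 * r * n := hkrn.trans hkrn2
    linarith

/-- The denominators of the updates stay away from `0` when the mean of `ψ` stays away from
`0` and `1`. -/
lemma normQuad_offDiag_le_of_mean {ψ : Fin n → ℝ} {δ b : ℝ} (hδ : 0 < δ) (hn : 3 ≤ n)
    (hb : |b| ≤ 1 / 2 - δ) (hψ : ∀ i, |centerHalf ψ i| ≤ 1 / 2)
    (hT : |∑ i, centerHalf ψ i - n * b| ≤ k * √n) (hnk : 2 * k ≤ δ * √n) (hnδ : 1 ≤ δ * n) :
    |normQuad (offDiag n) ψ| ≤ 1 - δ := by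
  have hn' : (3 : ℝ) ≤ n := by exact_mod_cast hn
  have hn0 : (0 : ℝ) < n := by linarith
  have hδ1 : δ ≤ 1 / 2 := by linarith [abs_nonneg b]
  have hD : 0 < (n : ℝ) * (n - 1) := by apply mul_pos <;> linarith
  have hs : √(n : ℝ) * √n = n := Real.mul_self_sqrt hn0.le
  have h1 : 2 * |∑ i, centerHalf ψ i| ≤ (1 - δ) * n := by
    have h2 : k * √n ≤ δ * n / 2 := by nlinarith [Real.sqrt_nonneg (n : ℝ)]
    have h3 : |n * b| ≤ n * (1 / 2 - δ) := by
      rw [abs_mul, abs_of_pos hn0]; gcongr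
    have h4 := abs_sub_abs_le_abs_sub (∑ i, centerHalf ψ i) (n * b)
    linarith
  have h2 := sum_sq_le_quarter hψ
  have h3 : 0 ≤ ∑ i, centerHalf ψ i ^ 2 := Finset.sum_nonneg fun i _ => sq_nonneg _
  have h4 : 4 * (∑ i, centerHalf ψ i) ^ 2 ≤ (1 - δ) ^ 2 * (n * n) := by
    have : (2 * |∑ i, centerHalf ψ i|) ^ 2 ≤ ((1 - δ) * n) ^ 2 := by gcongr
    rw [mul_pow, sq_abs] at this
    linarith
  rw [normQuad, abs_div, abs_of_pos hD, div_le_iff₀ hD, offDiag_quad, abs_le]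
  -- One factor `1 - δ` of the squared sum pays for the passage from `n²` to `n(n-1)`.
  have h5 : (1 - δ) * (n * n) ≤ n * (n - 1) := by nlinarith
  have h6 : (1 - δ) * ((1 - δ) * (n * n)) ≤ (1 - δ) * (n * (n - 1)) := by gcongr; linarith
  have h7 : (n : ℝ) ≤ (1 - δ) * (n * (n - 1)) := by
    have h8 : 1 / 2 * ((n : ℝ) * (n - 1)) ≤ (1 - δ) * (n * (n - 1)) := by gcongr; linarith
    nlinarith
  constructor <;> nlinarith [sq_nonneg (∑ i, centerHalf ψ i)]

end deterministic

/-! ### Tail bounds for the noise and the initialization -/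

/-- All parts are squares of linear forms in the entries of `X`, so one second-moment bound covers
them, and measurability is visible. -/
lemma fluctuation_eq {n : ℕ} (X : Matrix (Fin n) (Fin n) ℝ) (u : Fin n → ℝ) :
    fluctuation X u = (∑ i, ∑ j, 1 * X i j) ^ 2 + (∑ i, ∑ j, u i * u j * X i j) ^ 2 +
      ∑ k, (∑ i, ∑ j, (if i = k then u j else 0) * X i j) ^ 2 := by
  rw [fluctuation, l2_sq]
  congr 1
  · congr 2
    · simp
    · simp only [dotProduct, Matrix.mulVec, Finset.mul_sum]
      exact Finset.sum_congr rfl fun i _ => Finset.sum_congr rfl fun j _ => by ring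
  · refine Finset.sum_congr rfl fun k _ => ?_
    congr 1
    rw [Finset.sum_eq_single k (fun i _ hi => by simp [hi]) (by simp)]
    simp [Matrix.mulVec, dotProduct, mul_comm]

lemma fluctuation_nonneg {n : ℕ} (X : Matrix (Fin n) (Fin n) ℝ) (u : Fin n → ℝ) :
    0 ≤ fluctuation X u := by
  unfold fluctuation; positivity

lemma measurable_fluctuation {n : ℕ} (E : Matrix (Fin n) (Fin n) ℝ) :
    Measurable fun x : (Fin n → ℝ) × (Fin n → Fin n → ℝ) =>
      fluctuation (Matrix.of x.2 - E) (centerHalf x.1) := by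
  simp only [fluctuation_eq, centerHalf, Matrix.sub_apply, Matrix.of_apply, Pi.sub_apply]
  refine Measurable.add (by fun_prop) (Finset.measurable_fun_sum _ fun k _ => ?_)
  refine Measurable.pow_const (Finset.measurable_fun_sum _ fun i _ =>
    Finset.measurable_fun_sum _ fun j _ => ?_) 2
  split_ifs <;> fun_prop

/-- A bound on the probability of an event, uniform over the values of an independent variable. -/
lemma measure_le_of_indepFun {Ω α β : Type*} [MeasurableSpace Ω] [MeasurableSpace α]
    [MeasurableSpace β] {P : Measure Ω} [IsProbabilityMeasure P] {X : Ω → α} {Y : Ω → β}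
    (hX : AEMeasurable X P) (hY : AEMeasurable Y P) (h : IndepFun X Y P) {S : Set (α × β)}
    (hS : MeasurableSet S) {T : Set α} (hT : MeasurableSet T) (hXT : ∀ᵐ ω ∂P, X ω ∈ T)
    {ε : ENNReal} (hε : ∀ x ∈ T, P {ω | (x, Y ω) ∈ S} ≤ ε) : P {ω | (X ω, Y ω) ∈ S} ≤ ε := by
  have h1 : P {ω | (X ω, Y ω) ∈ S} = ((P.map X).prod (P.map Y)) S := by
    rw [← (indepFun_iff_map_prod_eq_prod_map_map hX hY).1 h,
      Measure.map_apply_of_aemeasurable (hX.prodMk hY) hS]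
    rfl
  have hprob : IsProbabilityMeasure (P.map X) := Measure.isProbabilityMeasure_map hX
  have hprob' : IsProbabilityMeasure (P.map Y) := Measure.isProbabilityMeasure_map hY
  rw [h1, Measure.prod_apply hS]
  have h2 : ∀ᵐ x ∂(P.map X), (P.map Y) (Prod.mk x ⁻¹' S) ≤ ε := by
    have h3 : ∀ᵐ x ∂(P.map X), x ∈ T := (ae_map_iff hX hT).2 hXT
    filter_upwards [h3] with x hx
    rw [Measure.map_apply_of_aemeasurable hY (measurable_prodMk_left hS)]
    exact hε x hx
  calc _ ≤ ∫⁻ _x, ε ∂(P.map X) := lintegral_mono_ae h2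
    _ = ε := by simp

section
variable {Ω : Type*} [MeasurableSpace Ω] {P : Measure Ω} {n : ℕ} {f : Measure ℝ}
  {ψ : Ω → Fin n → ℝ}

lemma IsIID.ae_mem (hψ : IsIID P f ψ) (hf : ∀ᵐ x ∂f, x ∈ Set.Ioo (0 : ℝ) 1) :
    ∀ᵐ ω ∂P, ∀ i, ψ ω i ∈ Set.Ioo (0 : ℝ) 1 :=
  ae_all_iff.2 fun i => ((hψ.hasLaw i).ae_iff measurableSet_Ioo.mem).2 hf

variable [IsProbabilityMeasure P]

/-- Markov's inequality for fixed `u`: the three parts contribute at most `2vn²`, `vn²` and `vn²` to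
the mean. -/
lemma IsSBM.fluctuation_tail {z : Fin n → Bool} {p q v : ℝ} {A : Ω → Matrix (Fin n) (Fin n) ℝ}
    (h : IsSBM P z p q A) (hp : 0 ≤ p) (hq : 0 ≤ q) (hpv : p ≤ v) (hqv : q ≤ v) {u : Fin n → ℝ}
    (hu : ∀ i, |u i| ≤ 1 / 2) {x : ℝ} (hx : 0 < x) :
    P {ω | x < fluctuation (A ω - meanMatrix z p q) u} ≤ ENNReal.ofReal (4 * v * n ^ 2 / x) := by
  have hv : 0 ≤ v := hp.trans hpv
  have hu2 : ∀ i, u i ^ 2 ≤ 1 / 4 := fun i => by nlinarith [abs_le.1 (hu i)]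
  have hI1 := h.integrable_sq_sum (fun _ _ => 1)
  have hI2 := h.integrable_sq_sum (fun i j => u i * u j)
  have hI3 := fun k => h.integrable_sq_sum (fun i j => if i = k then u j else 0)
  have hI12 : Integrable (fun ω => (∑ i, ∑ j, 1 * (A ω - meanMatrix z p q) i j) ^ 2 +
      (∑ i, ∑ j, u i * u j * (A ω - meanMatrix z p q) i j) ^ 2) P := hI1.add hI2
  have hI : Integrable (fun ω => fluctuation (A ω - meanMatrix z p q) u) P := by
    simp only [fluctuation_eq]
    exact hI12.add (integrable_finsetSum _ fun k _ => hI3 k)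
  have hE : ∫ ω, fluctuation (A ω - meanMatrix z p q) u ∂P ≤ 4 * v * n ^ 2 := by
    simp only [fluctuation_eq]
    rw [integral_add hI12 (integrable_finsetSum _ fun k _ => hI3 k),
      integral_add hI1 hI2, integral_finsetSum _ fun k _ => hI3 k]
    have e1 := h.integral_sq_sum_le hp hq hpv hqv (fun _ _ => 1)
    have e2 := h.integral_sq_sum_le hp hq hpv hqv (fun i j => u i * u j)
    have e3 : ∀ k, ∫ ω, (∑ i, ∑ j, (if i = k then u j else 0) *
        (A ω - meanMatrix z p q) i j) ^ 2 ∂P ≤ v * n := by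
      intro k
      refine (h.integral_sq_sum_le hp hq hpv hqv (fun i j => if i = k then u j else 0)).trans ?_
      have s1 : ∑ i, ∑ j, (if i = k then u j else 0) ^ 2 = ∑ j, u j ^ 2 := by
        rw [Finset.sum_eq_single k (fun i _ hi => by simp [hi]) (by simp)]
        simp
      have s2 := sum_sq_le_quarter hu
      rw [s1]
      nlinarith [Nat.cast_nonneg (α := ℝ) n]
    have s1 : ∑ _i : Fin n, ∑ _j : Fin n, (1 : ℝ) ^ 2 = n ^ 2 := by simp [sq]
    have s2 : ∑ i, ∑ j, (u i * u j) ^ 2 ≤ (n : ℝ) ^ 2 / 2 := by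
      calc ∑ i, ∑ j, (u i * u j) ^ 2 ≤ ∑ _i : Fin n, ∑ _j : Fin n, (1 / 2 : ℝ) := by
            refine Finset.sum_le_sum fun i _ => Finset.sum_le_sum fun j _ => ?_
            rw [mul_pow]
            nlinarith [hu2 i, hu2 j, sq_nonneg (u i), sq_nonneg (u j)]
        _ = n ^ 2 / 2 := by simp [sq]; ring
    have s3 : ∑ k : Fin n, ∫ ω, (∑ i, ∑ j, (if i = k then u j else 0) *
        (A ω - meanMatrix z p q) i j) ^ 2 ∂P ≤ v * n ^ 2 := by
      refine (Finset.sum_le_sum fun k _ => e3 k).trans (le_of_eq ?_)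
      simp; ring
    rw [s1] at e1
    have e2' : 2 * v * ∑ i, ∑ j, (u i * u j) ^ 2 ≤ 2 * v * (n ^ 2 / 2) := by gcongr
    linarith
  have hM := mul_meas_ge_le_integral_of_nonneg
    (ae_of_all _ fun ω => fluctuation_nonneg (A ω - meanMatrix z p q) u) hI x
  have h2 : P.real {ω | x ≤ fluctuation (A ω - meanMatrix z p q) u} ≤ 4 * v * n ^ 2 / x := by
    rw [le_div_iff₀ hx]; linarith
  calc P {ω | x < fluctuation (A ω - meanMatrix z p q) u}
      ≤ P {ω | x ≤ fluctuation (A ω - meanMatrix z p q) u} :=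
        measure_mono (Set.ofPred_subset_ofPred.2 fun ω hω => le_of_lt hω)
    _ = ENNReal.ofReal (P.real {ω | x ≤ fluctuation (A ω - meanMatrix z p q) u}) := by
        rw [Measure.real, ENNReal.ofReal_toReal (measure_ne_top _ _)]
    _ ≤ _ := ENNReal.ofReal_le_ofReal h2

/-- Chebyshev's inequality. The signs as `c` bound the signal, and `c = 1` controls the
denominators. -/
lemma IsIID.linear_tail (hψ : IsIID P f ψ) (hf : ∀ᵐ x ∂f, x ∈ Set.Ioo (0 : ℝ) 1)
    {c : Fin n → ℝ} (hc : ∀ i, |c i| ≤ 1) (hn : 0 < n) {k : ℝ} (hk : 0 < k) :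
    P {ω | k * √n < |∑ i, c i * centerHalf (ψ ω) i - (∑ i, c i) * (∫ x, x ∂f - 1 / 2)|} ≤
      ENNReal.ofReal (1 / k ^ 2) := by
  have hn0 : (0 : ℝ) < n := by exact_mod_cast hn
  have hb : ∀ i, ∀ᵐ ω ∂P, ψ ω i ∈ Set.Icc (0 : ℝ) 1 := fun i => by
    filter_upwards [hψ.ae_mem hf] with ω hω
    exact Set.Ioo_subset_Icc_self (hω i)
  have hL : ∀ i, MemLp (fun ω => ψ ω i) 2 P := fun i =>
    memLp_of_bounded (hb i) (hψ.hasLaw i).aemeasurable.aestronglyMeasurable _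
  have hLc : ∀ i, MemLp (fun ω => c i * ψ ω i) 2 P := fun i => (hL i).const_mul _
  have hvar : Var[∑ i, fun ω => c i * ψ ω i; P] ≤ n := by
    rw [IndepFun.variance_sum (fun i _ => hLc i)]
    · calc _ ≤ ∑ _i : Fin n, (1 : ℝ) := by
            refine Finset.sum_le_sum fun i _ => ?_
            rw [variance_const_mul]
            have h1 := variance_le_sq_of_bounded (hb i) (hψ.hasLaw i).aemeasurable
            have h2 : c i ^ 2 ≤ 1 := by nlinarith [abs_le.1 (hc i)]
            have h3 := variance_nonneg (fun ω => ψ ω i) P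
            nlinarith [sq_nonneg (c i)]
        _ = n := by simp
    · intro i _ j _ hij
      exact (hψ.indep.indepFun hij).comp (measurable_const_mul (c i)) (measurable_const_mul (c j))
  have hmean : ∫ ω, (∑ i, fun ω => c i * ψ ω i) ω ∂P = (∑ i, c i) * ∫ x, x ∂f := by
    simp only [Finset.sum_apply]
    rw [integral_finsetSum _ fun i _ => (hLc i).integrable (by norm_num), Finset.sum_mul]
    refine Finset.sum_congr rfl fun i _ => ?_
    rw [integral_const_mul, (hψ.hasLaw i).integral_eq]
  have hch := meas_ge_le_variance_div_sq (memLp_finsetSum' Finset.univ fun i _ => hLc i)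
    (c := k * √n) (by positivity)
  refine (measure_mono ?_).trans (hch.trans (ENNReal.ofReal_le_ofReal ?_))
  · intro ω hω
    simp only [Set.mem_ofPred_eq] at hω ⊢
    rw [hmean]
    refine hω.le.trans (le_of_eq ?_)
    congr 1
    simp only [Finset.sum_apply, centerHalf, Pi.sub_apply, mul_sub, Finset.sum_sub_distrib,
      ← Finset.sum_mul]
    ring
  · rw [mul_pow, Real.sq_sqrt hn0.le, div_le_div_iff₀ (by positivity) (by positivity)]
    nlinarith [sq_nonneg k]

lemma abs_centerHalf_le {ψ : Fin n → ℝ} (h : ∀ i, ψ i ∈ Set.Ioo (0 : ℝ) 1) (i : Fin n) :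
    |centerHalf ψ i| ≤ 1 / 2 := by
  have := h i
  simp only [centerHalf, Pi.sub_apply]
  rw [abs_le]; constructor <;> linarith [this.1, this.2]

/-- The bound for fixed `u` is uniform over the cube, so it survives inserting an independent random
`u`. -/
lemma fluctuation_tail_of_indepFun {z : Fin n → Bool} {p q v : ℝ}
    {A : Ω → Matrix (Fin n) (Fin n) ℝ} (h : IsSBM P z p q A) (hp : 0 ≤ p) (hq : 0 ≤ q)
    (hpv : p ≤ v) (hqv : q ≤ v) (hψ : IsIID P f ψ) (hf : ∀ᵐ x ∂f, x ∈ Set.Ioo (0 : ℝ) 1)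
    (hind : IndepFun ψ (fun ω i j => A ω i j) P) {x : ℝ} (hx : 0 < x) :
    P {ω | x < fluctuation (A ω - meanMatrix z p q) (centerHalf (ψ ω))} ≤
      ENNReal.ofReal (4 * v * n ^ 2 / x) := by
  have hX : AEMeasurable ψ P := aemeasurable_pi_lambda _ fun i => (hψ.hasLaw i).aemeasurable
  have hY : Measurable fun ω i j => A ω i j :=
    measurable_pi_lambda _ fun i => measurable_pi_lambda _ fun j => h.measurable_entry i j
  refine measure_le_of_indepFun (X := ψ) (Y := fun ω i j => A ω i j)
    (S := {y | x < fluctuation (Matrix.of y.2 - meanMatrix z p q) (centerHalf y.1)})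
    (T := Set.univ.pi fun _ => Set.Ioo (0 : ℝ) 1) hX hY.aemeasurable hind
    (measurableSet_lt measurable_const (measurable_fluctuation _))
    (MeasurableSet.univ_pi fun _ => measurableSet_Ioo) ?_ ?_
  · filter_upwards [hψ.ae_mem hf] with ω hω i _ using hω i
  · intro y hy
    exact h.fluctuation_tail hp hq hpv hqv (abs_centerHalf_le fun i => hy i trivial) hx

end

-- The first update

universe u in
-- Off an event of probability at most `ε`, the deterministic bound applies with `r` the root of the
-- mean density. Since `p` and `q` are at most four times that density, no asymptotics enter. The
-- bound on `normQuad` is part of the conclusion because passing to the complement needs it.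
lemma first_step_of_density_le {ε δ : ℝ} (hε : 0 < ε) (hδ : 0 < δ) :
    ∃ (C : ℝ) (m₀ : ℕ), 0 < C ∧ 2 ≤ m₀ ∧ ∀ m : ℕ, m₀ ≤ m → ∀ {Ω : Type u} [MeasurableSpace Ω]
      (P : Measure Ω) [IsProbabilityMeasure P] (z : Fin (2 * m) → Bool) (p q : ℝ)
      (A : Ω → Matrix (Fin (2 * m)) (Fin (2 * m)) ℝ) (f : Measure ℝ) (ψ : Ω → Fin (2 * m) → ℝ),
      (Finset.univ.filter fun i => z i = true).card = m → 0 < p → p < 1 → 0 < q → q < 1 →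
      density (meanMatrix z p q) ≤ 1 / 2 → IsSBM P z p q A →
      (∀ᵐ x ∂f, x ∈ Set.Ioo (0 : ℝ) 1) → ∫ x, x ∂f ∈ Set.Icc δ (1 - δ) → IsIID P f ψ →
      IndepFun ψ (fun ω i j => A ω i j) P →
      P {ω | ¬ (|normQuad (offDiag (2 * m)) (ψ ω)| ≤ 1 - δ ∧
        l2 (centerHalf (psiUpdate (A ω) (ψ ω))) ≤ C)} ≤ ENNReal.ofReal ε := by
  by_cases hδ1 : δ ≤ 1
  swap
  · refine ⟨1, 2, one_pos, le_rfl, ?_⟩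
    intro m _ Ω _ P _ z p q A f ψ _ _ _ _ _ _ _ _ hmean
    linarith [hmean.1, hmean.2]
  -- The exceptional events have probability at most `1/k²`, `1/k²` and `16/k²`, and `18/k² ≤ ε`.
  set k : ℝ := 1 + 18 / ε with hk
  have hk1 : 1 ≤ k := by rw [hk]; have : 0 < 18 / ε := by positivity
                         linarith
  have hk0 : 0 < k := by linarith
  have hkε : 18 / k ^ 2 ≤ ε := by
    rw [div_le_iff₀ (by positivity)]
    have h1 : 18 ≤ ε * k := by rw [hk, mul_add, mul_div_cancel₀ _ hε.ne']; linarith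
    have h2 : ε * k ≤ ε * k ^ 2 := by gcongr; nlinarith
    linarith
  obtain ⟨C, n₀, hC, -, H⟩ := step_bounded_of_density (K := 17 * k ^ 2) (η := δ)
    (by nlinarith) hδ hδ1
  refine ⟨C, n₀ + 2 + ⌈(2 * k / δ) ^ 2 + 1 / δ⌉₊, hC, by omega, ?_⟩
  intro m hm Ω _ P _ z p q A f ψ hz hp hp1 hq hq1 hd hA hf hmean hψ hind
  have hn3 : 3 ≤ 2 * m := by omega
  have hn' : (3 : ℝ) ≤ ((2 * m : ℕ) : ℝ) := by exact_mod_cast hn3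
  have hzs := sum_commSign hz
  obtain ⟨hpa, hqa⟩ := le_density_meanMatrix (z := z) hn3 hzs hp.le hq.le
  have ha0 : 0 < density (meanMatrix z p q) := by linarith
  set a := density (meanMatrix z p q) with ha
  set r := √a with hr
  have hr0 : 0 < r := Real.sqrt_pos.2 ha0
  have hra : r ^ 2 = a := Real.sq_sqrt ha0.le
  set b := ∫ x, x ∂f - 1 / 2 with hb
  have hbδ : |b| ≤ 1 / 2 - δ := by
    rw [abs_le]; constructor <;> linarith [hmean.1, hmean.2]
  have hnk : (2 * k / δ) ^ 2 + 1 / δ ≤ ((2 * m : ℕ) : ℝ) :=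
    (Nat.le_ceil _).trans (by exact_mod_cast (by omega))
  have hnk1 : 2 * k ≤ δ * √((2 * m : ℕ) : ℝ) := by
    have h1 : 2 * k / δ ≤ √((2 * m : ℕ) : ℝ) := by
      apply Real.le_sqrt_of_sq_le
      have : 0 < 1 / δ := by positivity
      linarith
    rw [div_le_iff₀ hδ] at h1
    linarith
  have hnk2 : 1 ≤ δ * ((2 * m : ℕ) : ℝ) := by
    have h1 : 1 / δ ≤ ((2 * m : ℕ) : ℝ) := by nlinarith [sq_nonneg (2 * k / δ)]
    rw [div_le_iff₀ hδ] at h1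
    linarith
  have hn0 : (0 : ℝ) < ((2 * m : ℕ) : ℝ) := by linarith
  set B₀ := {ω | ¬ ∀ i, ψ ω i ∈ Set.Ioo (0 : ℝ) 1} with hB₀
  set B₁ := {ω | k * √((2 * m : ℕ) : ℝ) <
    |∑ i, commSign z i * centerHalf (ψ ω) i - (∑ i, commSign z i) * b|} with hB₁
  set B₂ := {ω | k * √((2 * m : ℕ) : ℝ) <
    |∑ i, 1 * centerHalf (ψ ω) i - (∑ _i : Fin (2 * m), 1) * b|} with hB₂
  set B₃ := {ω | (k * r * ((2 * m : ℕ) : ℝ)) ^ 2 <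
    fluctuation (A ω - meanMatrix z p q) (centerHalf (ψ ω))} with hB₃
  have hsub : {ω | ¬ (|normQuad (offDiag (2 * m)) (ψ ω)| ≤ 1 - δ ∧
      l2 (centerHalf (psiUpdate (A ω) (ψ ω))) ≤ C)} ⊆ B₀ ∪ B₁ ∪ B₂ ∪ B₃ := by
    intro ω hω
    by_contra hcon
    simp only [hB₀, hB₁, hB₂, hB₃, Set.mem_union, Set.mem_ofPred_eq, not_or, not_not, not_lt] at hcon
    obtain ⟨⟨⟨h0, h1⟩, h2⟩, h3⟩ := hcon
    rw [hzs, zero_mul, sub_zero] at h1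
    simp only [one_mul, Finset.sum_const, Finset.card_univ, Fintype.card_fin, nsmul_eq_mul,
      mul_one] at h2
    have hu := abs_centerHalf_le h0
    have hU := normQuad_offDiag_le_of_mean hδ hn3 hbδ hu h2 hnk1 hnk2
    obtain ⟨c1, c2, c3⟩ := centered_bounds hn3 hzs hp.le hq.le hp1.le hq1.le hu hk1 h1 hr h3
    exact hω ⟨hU, H (2 * m) (by omega) (A ω) (ψ ω) r (hA.isAdjacency ω) hu hr0.le
      (by rw [hra]; exact hd) c1 c2 c3 hU⟩
  have m0 : P B₀ = 0 := hψ.ae_mem hf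
  have m1 : P B₁ ≤ ENNReal.ofReal (1 / k ^ 2) :=
    hψ.linear_tail hf (fun i => (abs_commSign z i).le) (by omega) hk0
  have m2 : P B₂ ≤ ENNReal.ofReal (1 / k ^ 2) :=
    hψ.linear_tail hf (c := fun _ => 1) (fun i => by simp) (by omega) hk0
  have m3 : P B₃ ≤ ENNReal.ofReal (16 / k ^ 2) := by
    refine (fluctuation_tail_of_indepFun hA hp.le hq.le hpa hqa hψ hf hind
      (by positivity)).trans (ENNReal.ofReal_le_ofReal (le_of_eq ?_))
    rw [← hra]
    field_simp
    norm_num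
  calc _ ≤ P (B₀ ∪ B₁ ∪ B₂ ∪ B₃) := measure_mono hsub
    _ ≤ P B₀ + P B₁ + P B₂ + P B₃ :=
        (measure_union_le _ _).trans (add_le_add_left ((measure_union_le _ _).trans
          (add_le_add_left (measure_union_le _ _) _)) _)
    _ ≤ 0 + ENNReal.ofReal (1 / k ^ 2) + ENNReal.ofReal (1 / k ^ 2) +
        ENNReal.ofReal (16 / k ^ 2) := by gcongr; exact m0.le
    _ = ENNReal.ofReal (18 / k ^ 2) := by
        rw [zero_add, ← ENNReal.ofReal_add (by positivity) (by positivity),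
          ← ENNReal.ofReal_add (by positivity) (by positivity)]
        congr 1; ring
    _ ≤ _ := ENNReal.ofReal_le_ofReal hkε

universe u in
/-- The first update moves a random initialization to a bounded distance from `1/2`, uniformly
over all edge probabilities. -/
lemma first_step {ε δ : ℝ} (hε : 0 < ε) (hδ : 0 < δ) :
    ∃ (C : ℝ) (m₀ : ℕ), 0 < C ∧ ∀ m : ℕ, m₀ ≤ m → ∀ {Ω : Type u} [MeasurableSpace Ω]
      (P : Measure Ω) [IsProbabilityMeasure P] (z : Fin (2 * m) → Bool) (p q : ℝ)
      (A : Ω → Matrix (Fin (2 * m)) (Fin (2 * m)) ℝ) (f : Measure ℝ) (ψ : Ω → Fin (2 * m) → ℝ),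
      (Finset.univ.filter fun i => z i = true).card = m → 0 < p → p < 1 → 0 < q → q < 1 →
      IsSBM P z p q A → (∀ᵐ x ∂f, x ∈ Set.Ioo (0 : ℝ) 1) → ∫ x, x ∂f ∈ Set.Icc δ (1 - δ) →
      IsIID P f ψ → IndepFun ψ (fun ω i j => A ω i j) P →
      P {ω | C < l2 (centerHalf (psiUpdate (A ω) (ψ ω)))} ≤ ENNReal.ofReal ε := by
  obtain ⟨C, m₀, hC, hm₀, H⟩ := first_step_of_density_le.{u} hε hδ
  refine ⟨C, m₀, hC, ?_⟩
  intro m hm Ω _ P _ z p q A f ψ hz hp hp1 hq hq1 hA hf hmean hψ hind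
  by_cases hd : density (meanMatrix z p q) ≤ 1 / 2
  · refine (measure_mono ?_).trans (H m hm P z p q A f ψ hz hp hp1 hq hq1 hd hA hf hmean hψ hind)
    intro ω (hω : C < _) h
    exact absurd h.2 hω.not_ge
  · have hn2 : 2 ≤ 2 * m := by omega
    have e : meanMatrix z (1 - p) (1 - q) = offDiag (2 * m) - meanMatrix z p q := by
      ext i j
      simp only [meanMatrix, Matrix.of_apply, Matrix.sub_apply, offDiag_apply]
      split_ifs <;> ring
    have hd' : density (meanMatrix z (1 - p) (1 - q)) ≤ 1 / 2 := by
      rw [e, IsAdjacency.density_complement hn2]; linarith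
    have hind' : IndepFun ψ (fun ω i j => (offDiag (2 * m) - A ω) i j) P := by
      have hφ : Measurable fun (B : Fin (2 * m) → Fin (2 * m) → ℝ) i j =>
          offDiag (2 * m) i j - B i j := by fun_prop
      exact hind.comp measurable_id hφ
    refine (measure_mono ?_).trans (H m hm P z (1 - p) (1 - q) _ f ψ hz (by linarith) (by linarith)
      (by linarith) (by linarith) hd' hA.complement hf hmean hψ hind')
    intro ω (hω : C < _) h
    rw [psiUpdate_complement hn2 _ (by linarith [h.1])] at h
    exact absurd h.2 hω.not_ge

/-! ### Concentration of degrees and density, and the later updates -/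

lemma IsSBM.exists_degree_tail {Ω : Type*} [MeasurableSpace Ω] {P : Measure Ω}
    [IsProbabilityMeasure P] {n : ℕ} {z : Fin n → Bool} {p q v : ℝ}
    {A : Ω → Matrix (Fin n) (Fin n) ℝ} (h : IsSBM P z p q A) (hp : 0 ≤ p) (hq : 0 ≤ q)
    (hpv : p ≤ v) (hqv : q ≤ v) (x : ℝ) :
    P {ω | ∃ i, x ≤ ∑ j, A ω i j} ≤ ENNReal.ofReal (n * Real.exp (2 * v * n - x)) := by
  have e : {ω | ∃ i, x ≤ ∑ j, A ω i j} = ⋃ i, {ω | x ≤ ∑ j, A ω i j} := by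
    ext ω; simp
  rw [e]
  refine (measure_iUnion_fintype_le _ _).trans ?_
  have h1 : ∀ i : Fin n, P {ω | x ≤ ∑ j, A ω i j} ≤ ENNReal.ofReal (Real.exp (2 * v * n - x)) := by
    intro i
    rw [← ENNReal.ofReal_toReal (measure_ne_top P {ω | x ≤ ∑ j, A ω i j})]
    exact ENNReal.ofReal_le_ofReal (h.degree_tail hp hq hpv hqv i x)
  refine (Finset.sum_le_sum fun i _ => h1 i).trans (le_of_eq ?_)
  rw [Finset.sum_const, Finset.card_univ, Fintype.card_fin, nsmul_eq_mul,
    ENNReal.ofReal_mul (by positivity), ENNReal.ofReal_natCast]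

/-- The edge density concentrates around its mean. -/
lemma IsSBM.density_tail {Ω : Type*} [MeasurableSpace Ω] {P : Measure Ω}
    [IsProbabilityMeasure P] {n : ℕ} (hn : 2 ≤ n) {z : Fin n → Bool} {p q v : ℝ}
    {A : Ω → Matrix (Fin n) (Fin n) ℝ} (h : IsSBM P z p q A) (hp : 0 ≤ p) (hq : 0 ≤ q)
    (hpv : p ≤ v) (hqv : q ≤ v) {y : ℝ} (hy : 0 < y) :
    P {ω | y < |density (A ω) - density (meanMatrix z p q)|} ≤
      ENNReal.ofReal (16 * v / (y * n) ^ 2) := by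
  have hn' : (2 : ℝ) ≤ n := by exact_mod_cast hn
  have hn0 : (0 : ℝ) < n := by linarith
  -- With `u = 0` only the total sum remains in `fluctuation`.
  have hF := h.fluctuation_tail hp hq hpv hqv (u := fun _ => 0) (fun i => by norm_num)
    (x := (y * n / 2 * n) ^ 2) (by positivity)
  refine (measure_mono (Set.ofPred_subset_ofPred.2 fun ω hω => ?_)).trans
    (hF.trans (ENNReal.ofReal_le_ofReal (le_of_eq (by field_simp; ring))))
  by_contra hcon
  have h1 : |∑ i, ∑ j, (A ω - meanMatrix z p q) i j| ≤ y * n / 2 * n := by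
    apply abs_le_of_sq_le_sq _ (by positivity)
    unfold fluctuation at hcon
    linarith [sq_nonneg ((fun _ => 0 : Fin n → ℝ) ⬝ᵥ (A ω - meanMatrix z p q) *ᵥ fun _ => 0),
      sq_nonneg (l2 ((A ω - meanMatrix z p q) *ᵥ fun _ => 0))]
  have h2 := abs_density_sub_le hn h1
  rw [show 2 * (y * n / 2) / (n : ℝ) = y by field_simp] at h2
  linarith

lemma abs_distHalf {n : ℕ} (ψ : Fin n → ℝ) : |distHalf ψ| = l2 (centerHalf ψ) := by
  rw [distHalf_eq, abs_of_nonneg (l2_nonneg _)]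

lemma iterate_succ {n : ℕ} (A : Matrix (Fin n) (Fin n) ℝ) (ψ : Fin n → ℝ) (s : ℕ) :
    iterate A ψ (s + 1) = psiUpdate A (iterate A ψ s) := Function.iterate_succ_apply' _ _ _

lemma abs_centerHalf_iterate_le {n : ℕ} (A : Matrix (Fin n) (Fin n) ℝ) (ψ : Fin n → ℝ) {s : ℕ}
    (hs : 1 ≤ s) (i : Fin n) : |centerHalf (iterate A ψ s) i| ≤ 1 / 2 := by
  obtain ⟨t, rfl⟩ := Nat.exists_eq_add_of_le' hs
  rw [iterate_succ]
  exact abs_centerHalf_psiUpdate_le _ _ i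

section asymptotics
variable {Ω : ℕ → Type*} [∀ m, MeasurableSpace (Ω m)] {P : ∀ m, Measure (Ω m)}
  {A : ∀ m, Ω m → Matrix (Fin (2 * m)) (Fin (2 * m)) ℝ} {ψ₀ : ∀ m, Ω m → Fin (2 * m) → ℝ}

/-- `step_bounded` holds for every graph, so the exceptional event does not grow. -/
lemma isBigOP_iterate_succ (hA : ∀ m ω, IsAdjacency (A m ω)) {s : ℕ} (hs : 1 ≤ s)
    (h : IsBigOP P (fun m ω => distHalf (iterate (A m ω) (ψ₀ m ω) s)) (fun _ => 1)) :
    IsBigOP P (fun m ω => distHalf (iterate (A m ω) (ψ₀ m ω) (s + 1))) (fun _ => 1) := by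
  intro ε hε
  obtain ⟨C, hC, hev⟩ := h ε hε
  obtain ⟨C', hC', H⟩ := step_bounded C
  refine ⟨C', hC', ?_⟩
  filter_upwards [hev] with m hm
  refine (measure_mono (Set.ofPred_subset_ofPred.2 fun ω hω => ?_)).trans hm
  rw [abs_distHalf, mul_one] at hω ⊢
  rw [iterate_succ] at hω
  by_contra hcon
  exact absurd (H _ _ _ (hA m ω) (abs_centerHalf_iterate_le _ _ hs) (not_lt.1 hcon)) hω.not_ge

/-- The second logarithm outgrows the unknown constant in `O`; what remains is the margin needed for
a union bound over degrees. -/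
lemma eventually_two_mul_log_le {ρ : ℕ → ℝ} (hρ : ∀ m, 0 < ρ m)
    (hlog : (fun m : ℕ => Real.log ((2 * m : ℕ) : ℝ) ^ 2) =O[atTop]
      fun m : ℕ => ((2 * m : ℕ) : ℝ) * ρ m) :
    ∀ᶠ m in atTop, 2 * Real.log ((2 * m : ℕ) : ℝ) ≤ ((2 * m : ℕ) : ℝ) * ρ m := by
  obtain ⟨c, hc, hb⟩ := hlog.exists_pos
  have ht : Tendsto (fun m : ℕ => Real.log ((2 * m : ℕ) : ℝ)) atTop atTop :=
    Real.tendsto_log_atTop.comp (tendsto_natCast_atTop_atTop.comp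
      (tendsto_id.const_mul_atTop' (by norm_num : 0 < 2)))
  filter_upwards [hb.bound, ht.eventually_ge_atTop (2 * c)] with m hm hm2
  have h0 : 0 ≤ ((2 * m : ℕ) : ℝ) * ρ m := mul_nonneg (by positivity) (hρ m).le
  rw [Real.norm_of_nonneg (sq_nonneg _), Real.norm_of_nonneg h0] at hm
  have h1 : c * (2 * Real.log ((2 * m : ℕ) : ℝ)) ≤ c * (((2 * m : ℕ) : ℝ) * ρ m) := by
    nlinarith
  exact le_of_mul_le_mul_left h1 hc

lemma isBigOP_iterate_of_bounded [∀ m, IsProbabilityMeasure (P m)] {p₀ q₀ ρ : ℕ → ℝ}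
    (hρ : ∀ m, 0 < ρ m) (hq : ∀ m, 0 < q₀ m) (hpq : ∀ m, q₀ m < p₀ m) (hp : ∀ m, p₀ m < 1)
    (hpρ : p₀ =O[atTop] ρ) (hqρ : ρ =O[atTop] q₀)
    (hlog : (fun m : ℕ => Real.log ((2 * m : ℕ) : ℝ) ^ 2) =O[atTop]
      fun m : ℕ => ((2 * m : ℕ) : ℝ) * ρ m)
    {z : ∀ m, Fin (2 * m) → Bool}
    (hz : ∀ m, (Finset.univ.filter fun i => z m i = true).card = m)
    (hA : ∀ m, IsSBM (P m) (z m) (p₀ m) (q₀ m) (A m)) {s : ℕ} (hs : 1 ≤ s)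
    (h : IsBigOP P (fun m ω => distHalf (iterate (A m ω) (ψ₀ m ω) s)) (fun _ => 1)) :
    IsBigOP P (fun m ω => distHalf (iterate (A m ω) (ψ₀ m ω) (s + 1)))
      (fun m => Real.sqrt (ρ m)) := by
  intro ε hε
  obtain ⟨C, hC, hev⟩ := h (ε / 3) (by positivity)
  obtain ⟨c₁, hc₁, hb₁⟩ := hpρ.exists_pos
  obtain ⟨c₂, hc₂, hb₂⟩ := hqρ.exists_pos
  obtain ⟨C₁, hC₁, H₁⟩ := step_bounded C
  obtain ⟨C₂, n₀, hC₂, H₂⟩ := step_contracts (D := 2 * c₁ + 1) (c := 1 / (8 * c₂)) hC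
    (by positivity) (by positivity)
  refine ⟨C₁ * √(4 * c₁) + C₂ * √c₂, by positivity, ?_⟩
  have hlogt : Tendsto (fun m : ℕ => Real.log ((2 * m : ℕ) : ℝ)) atTop atTop :=
    Real.tendsto_log_atTop.comp (tendsto_natCast_atTop_atTop.comp
      (tendsto_id.const_mul_atTop' (by norm_num : 0 < 2)))
  filter_upwards [hev, hb₁.bound, hb₂.bound, eventually_two_mul_log_le hρ hlog,
    hlogt.eventually_ge_atTop (1024 * c₁ * c₂ ^ 2 * (3 / ε)),
    hlogt.eventually_ge_atTop (Real.log (3 / ε)), eventually_ge_atTop n₀, eventually_ge_atTop 2]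
    with m hm hp1 hq1 hl1 hl2 hl3 hn₀ hm2
  have hρm := hρ m
  have hqm := hq m
  have hpqm := hpq m
  have hpm := hp m
  rw [Real.norm_of_nonneg (by linarith), Real.norm_of_nonneg hρm.le] at hp1
  rw [Real.norm_of_nonneg hρm.le, Real.norm_of_nonneg hqm.le] at hq1
  have hρc : ρ m ≤ c₂ := hq1.trans (by nlinarith)
  have hsρ : 0 < √(ρ m) := Real.sqrt_pos.2 hρm
  have hss : √(ρ m) * √(ρ m) = ρ m := Real.mul_self_sqrt hρm.le
  have hn3 : 3 ≤ 2 * m := by omega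
  have hn' : (3 : ℝ) ≤ ((2 * m : ℕ) : ℝ) := by exact_mod_cast hn3
  set N : ℝ := ((2 * m : ℕ) : ℝ) with hN
  have hN0 : 0 < N := by linarith
  set B₁ := {ω | C * 1 < |distHalf (iterate (A m ω) (ψ₀ m ω) s)|} with hB₁
  -- For `ρ` bounded below, `1 = O(√ρ)` and `step_bounded` suffices. Otherwise `p₀ < 1/4`, so with
  -- high probability the density is at most `1/2`, as `step_contracts` requires.
  by_cases hcase : 1 / (4 * c₁) ≤ ρ m
  · refine (measure_mono ?_).trans (hm.trans (ENNReal.ofReal_le_ofReal (by linarith)))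
    refine Set.ofPred_subset_ofPred.2 fun ω hω => ?_
    by_contra hcon
    rw [abs_distHalf, mul_one, not_lt] at hcon
    have h1 := H₁ _ _ _ ((hA m).isAdjacency ω) (abs_centerHalf_iterate_le _ _ hs) hcon
    rw [abs_distHalf, iterate_succ] at hω
    have h2 : 1 ≤ √(4 * c₁) * √(ρ m) := by
      rw [← Real.sqrt_mul (by positivity), Real.one_le_sqrt]
      rwa [div_le_iff₀ (by positivity), mul_comm] at hcase
    have h3 : C₁ ≤ C₁ * (√(4 * c₁) * √(ρ m)) := le_mul_of_one_le_right hC₁.le h2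
    have h4 : 0 ≤ C₂ * √c₂ * √(ρ m) := by positivity
    linarith
  rw [not_le, lt_div_iff₀ (by positivity)] at hcase
  have hzs := sum_commSign (hz m)
  set a := density (meanMatrix (z m) (p₀ m) (q₀ m)) with ha
  have haq : q₀ m ≤ 4 * a := (le_density_meanMatrix hn3 hzs (by linarith) hqm.le).2
  have hap : a ≤ p₀ m := density_meanMatrix_le (by omega) le_rfl hpqm.le
  -- The mean density is at least `q₀/4 ≥ 2y`, so a deviation of at most `y` leaves a density of at
  -- least `y`.
  set y := ρ m / (8 * c₂) with hy
  have hy0 : 0 < y := by positivity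
  have hyq : 8 * y ≤ q₀ m := by
    rw [hy, ← mul_div_assoc, div_le_iff₀ (by positivity)]; linarith
  set B₂ := {ω | y < |density (A m ω) - a|} with hB₂
  set B₃ := {ω | ∃ i, (2 * c₁ + 1) * (N * ρ m) ≤ ∑ j, A m ω i j} with hB₃
  have hsub : {ω | (C₁ * √(4 * c₁) + C₂ * √c₂) * √(ρ m) <
      |distHalf (iterate (A m ω) (ψ₀ m ω) (s + 1))|} ⊆ B₁ ∪ B₂ ∪ B₃ := by
    intro ω hω
    by_contra hcon
    simp only [hB₁, hB₂, hB₃, Set.mem_union, Set.mem_ofPred_eq, not_or, not_lt, not_exists, not_le,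
      mul_one, abs_distHalf] at hcon hω
    obtain ⟨⟨h1, h2⟩, h3⟩ := hcon
    obtain ⟨h4, h5⟩ := abs_le.1 h2
    rw [iterate_succ] at hω
    have h6 := H₂ (2 * m) (by omega) _ _ (ρ m) ((hA m).isAdjacency ω) hρm
      (by rw [div_mul_eq_mul_div, one_mul, ← hy]; linarith) (by linarith)
      (fun i => (h3 i).le) h1
    have h7 : √(ρ m) ≤ √c₂ := Real.sqrt_le_sqrt hρc
    have h8 : C₂ * ρ m ≤ C₂ * √c₂ * √(ρ m) := by
      calc C₂ * ρ m = C₂ * √(ρ m) * √(ρ m) := by rw [mul_assoc, hss]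
        _ ≤ _ := by gcongr
    have h9 : 0 ≤ C₁ * √(4 * c₁) * √(ρ m) := by positivity
    linarith
  have hNρ : 0 < N * ρ m := by positivity
  have m2 : P m B₂ ≤ ENNReal.ofReal (ε / 3) := by
    refine ((hA m).density_tail (by omega) (by linarith) hqm.le le_rfl hpqm.le hy0).trans
      (ENNReal.ofReal_le_ofReal ?_)
    have hx0 : 0 ≤ 1024 * c₁ * c₂ ^ 2 * (3 / ε) := by positivity
    have h1 : 1024 * c₁ * c₂ ^ 2 * (3 / ε) ≤ N * ρ m := by linarith
    have h2 : N * ρ m ≤ N * (N * ρ m) := le_mul_of_one_le_left hNρ.le (by linarith)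
    have h3 : 1024 * c₁ * c₂ ^ 2 ≤ N * (N * ρ m) * (ε / 3) := by
      calc 1024 * c₁ * c₂ ^ 2 = 1024 * c₁ * c₂ ^ 2 * (3 / ε) * (ε / 3) := by field_simp
        _ ≤ _ := mul_le_mul_of_nonneg_right (h1.trans h2) (by positivity)
    rw [div_le_iff₀ (by positivity)]
    calc 16 * p₀ m ≤ 16 * (c₁ * ρ m) := by gcongr
      _ = (1024 * c₁ * c₂ ^ 2) * (ρ m / (64 * c₂ ^ 2)) := by field_simp; norm_num
      _ ≤ (N * (N * ρ m) * (ε / 3)) * (ρ m / (64 * c₂ ^ 2)) := by gcongr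
      _ = ε / 3 * (y * N) ^ 2 := by rw [hy]; field_simp; norm_num
  have m3 : P m B₃ ≤ ENNReal.ofReal (ε / 3) := by
    refine ((hA m).exists_degree_tail (by linarith) hqm.le le_rfl hpqm.le _).trans
      (ENNReal.ofReal_le_ofReal ?_)
    rw [← hN]
    -- The choice `2 * c₁ + 1` leaves the exponent `-Nρ ≤ -2 log N`; the union over `N` vertices
    -- then has probability at most `1/N`.
    have h1 : 2 * p₀ m * N - (2 * c₁ + 1) * (N * ρ m) ≤ -(2 * Real.log N) := by
      have : 2 * p₀ m * N ≤ 2 * (c₁ * ρ m) * N := by gcongr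
      linarith
    calc N * Real.exp (2 * p₀ m * N - (2 * c₁ + 1) * (N * ρ m))
        ≤ Real.exp (Real.log N) * Real.exp (-(2 * Real.log N)) := by
          rw [Real.exp_log hN0]; gcongr
      _ = Real.exp (-Real.log N) := by rw [← Real.exp_add]; ring_nf
      _ ≤ Real.exp (-Real.log (3 / ε)) := by gcongr
      _ = ε / 3 := by rw [← Real.log_inv, Real.exp_log (by positivity), inv_div]
  calc _ ≤ P m (B₁ ∪ B₂ ∪ B₃) := measure_mono hsub
    _ ≤ P m B₁ + P m B₂ + P m B₃ :=
        (measure_union_le _ _).trans (add_le_add_left (measure_union_le _ _) _)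
    _ ≤ ENNReal.ofReal (ε / 3) + ENNReal.ofReal (ε / 3) + ENNReal.ofReal (ε / 3) := by gcongr
    _ = ENNReal.ofReal ε := by
        rw [← ENNReal.ofReal_add (by positivity) (by positivity),
          ← ENNReal.ofReal_add (by positivity) (by positivity)]
        congr 1; ring

end asymptotics

end BCAVI

end

theorem mainTheorem4
    -- the `m`-th model has `n = 2 m` nodes; all sequences are indexed by `m`
    {Ω : ℕ → Type*} [∀ m, MeasurableSpace (Ω m)]
    (P : ∀ m, Measure (Ω m)) [∀ m, IsProbabilityMeasure (P m)]
    -- true parameters: `p₀ ≍ q₀ ≍ ρ_n`, `n ρ_n = Ω(log² n)`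
    (p₀ q₀ ρ : ℕ → ℝ)
    (hρ : ∀ m, 0 < ρ m)
    (hq : ∀ m, 0 < q₀ m) (hpq : ∀ m, q₀ m < p₀ m) (hp : ∀ m, p₀ m < 1)
    (hpρ : p₀ =Θ[atTop] ρ) (hqρ : q₀ =Θ[atTop] ρ)
    (hlog : (fun m : ℕ => Real.log ((2 * m : ℕ) : ℝ) ^ 2) =O[atTop]
      fun m : ℕ => ((2 * m : ℕ) : ℝ) * ρ m)
    -- two communities of equal size, and the observed network
    (z : ∀ m, Fin (2 * m) → Bool)
    (hz : ∀ m, (Finset.univ.filter fun i => z m i = true).card = m)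
    (A : ∀ m, Ω m → Matrix (Fin (2 * m)) (Fin (2 * m)) ℝ)
    (hA : ∀ m, BCAVI.IsSBM (P m) (z m) (p₀ m) (q₀ m) (A m))
    -- the law of the initialization: supported on `(0,1)`, mean bounded away from `0` and `1`
    (f : ℕ → Measure ℝ) [∀ m, IsProbabilityMeasure (f m)]
    (hf : ∀ m, ∀ᵐ x ∂(f m), x ∈ Set.Ioo (0 : ℝ) 1)
    (δ : ℝ) (hδ : 0 < δ)
    (hmean : ∀ m, ∫ x, x ∂(f m) ∈ Set.Icc δ (1 - δ))
    -- i.i.d. initialization, independent of the network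
    (ψ₀ : ∀ m, Ω m → Fin (2 * m) → ℝ)
    (hψ : ∀ m, BCAVI.IsIID (P m) (f m) (ψ₀ m))
    (hind : ∀ m, IndepFun (ψ₀ m) (fun ω i j => A m ω i j) (P m)) :
    BCAVI.IsBigOP P (fun m ω => BCAVI.distHalf (BCAVI.iterate (A m ω) (ψ₀ m ω) 1))
        (fun _ => 1) ∧
      ∀ s : ℕ, 2 ≤ s →
        BCAVI.IsBigOP P (fun m ω => BCAVI.distHalf (BCAVI.iterate (A m ω) (ψ₀ m ω) s))
          (fun m => Real.sqrt (ρ m)) := by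
  have h1 : BCAVI.IsBigOP P (fun m ω => BCAVI.distHalf (BCAVI.iterate (A m ω) (ψ₀ m ω) 1))
      (fun _ => 1) := by
    intro ε hε
    obtain ⟨C, m₀, hC, H⟩ := BCAVI.first_step hε hδ
    refine ⟨C, hC, ?_⟩
    filter_upwards [eventually_ge_atTop m₀] with m hm
    refine le_trans (measure_mono (Set.ofPred_subset_ofPred.2 fun ω hω => ?_))
      (H m hm (P m) (z m) (p₀ m) (q₀ m) (A m) (f m) (ψ₀ m) (hz m) ((hq m).trans (hpq m)) (hp m)
        (hq m) ((hpq m).trans (hp m)) (hA m) (hf m) (hmean m) (hψ m) (hind m))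
    rwa [BCAVI.abs_distHalf, mul_one] at hω
  -- Boundedness is carried through all iterates, and the rate `√ρ` is gained in the last update
  -- alone.
  have hs : ∀ s : ℕ, 1 ≤ s → BCAVI.IsBigOP P
      (fun m ω => BCAVI.distHalf (BCAVI.iterate (A m ω) (ψ₀ m ω) s)) (fun _ => 1) := by
    intro s hs
    induction s, hs using Nat.le_induction with
    | base => exact h1
    | succ s hs ih => exact BCAVI.isBigOP_iterate_succ (fun m ω => (hA m).isAdjacency ω) hs ih
  refine ⟨h1, fun s hs2 => ?_⟩
  obtain ⟨t, rfl⟩ := Nat.exists_eq_add_of_le' (Nat.le_of_succ_le hs2)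
  have ht : 1 ≤ t := by omega
  exact BCAVI.isBigOP_iterate_of_bounded hρ hq hpq hp hpρ.1 hqρ.2 hlog hz hA ht (hs t ht)
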